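/- **Setting.** Let $d\ge 1$, let $\Lambda=(\mathbb R/\mathbb Z)^d$ be the unit torus with Lebesgue measure $dr$, and for $\gamma=1/n$ with $n$ odd let $\Lambda_\gamma=\mathbb Z^d/n\mathbb Z^d$, whose points are represented in $\{-\frac{n-1}2,\dots,\frac{n-1}2\}^d$; limits $\gamma\to0$ are taken along these values. Let $J\in C^1(\Lambda)$ with $J(-r)=J(r)$ and $\int_\Lambda J\,dr=1$ (no sign condition), $\theta>0$, $T>0$, $a_1\ne a_2$ real, $p_1+p_2=1$. The disorder $\alpha=(\alpha(x))_{x\in\mathbb Z^d}$ is a family of i.i.d. random variables on a probability space with law $\mathbb P$, $\mathbb P(\alpha(x)=a_i)=p_i$, $i=1,2$; through the representatives it defines a field on $\Lambda_\gamma$, and $\alpha_i(x)=\mathbf 1_{\{\alpha(x)=a_i\}}$. For $\sigma\in\{-1,1\}^{\Lambda_\gamma}$ let $\sigma^x$ be $\sigma$ with the spin at $x$ flipped, $$H^{\gamma,\alpha}(\sigma)=-\tfrac12\sum_{x,y\in\Lambda_\gamma}\gamma^dJ(\gamma(x-y))\sigma(x)\sigma(y)-\theta\sum_{x\in\Lambda_\gamma}\alpha(x)\sigma(x),\qquad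 c_x^{\gamma,\alpha}(\sigma)=\frac{e^{-\frac12[H^{\gamma,\alpha}(\sigma^x)-H^{\gamma,\alpha}(\sigma)]}}{2\cosh\big(\frac12[H^{\gamma,\alpha}(\sigma^x)-H^{\gamma,\alpha}(\sigma)]\big)} .$$ Let $\overline V=(V_1,V_2)$, where each $V_i$ is continuous on $[0,T]\times\Lambda$ with a continuous time derivative there, and $$c_x^{\overline V,\gamma,\alpha}(\sigma,t)=e^{-2\sigma(x)\sum_{i}\alpha_i(x)V_i(t,\gamma x)}\,c_x^{\gamma,\alpha}(\sigma),\qquad \mathcal L_t^{\overline V,\gamma,\alpha}f(\sigma)=\sum_{x\in\Lambda_\gamma}c_x^{\overline V,\gamma,\alpha}(\sigma,t)\,[f(\sigma^x)-f(\sigma)].$$ For a configuration $\sigma^\gamma$, let $P^{\overline V,\gamma,\alpha}_{\sigma^\gamma}$ be the law on $D([0,T],\{-1,1\}^{\Lambda_\gamma})$ of the time-inhomogeneous Glauber process started from $\sigma^\gamma$, i.e. the solution of the martingale problem: $\sigma_0=\sigma^\gamma$ almost surely and $f(\sigma_t)-f(\sigma_0)-\int_0^t\mathcal L_s^{\overline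 V,\gamma,\alpha}f(\sigma_s)\,ds$ is a martingale for the canonical filtration, for every $f$. For $\overline G=(G_1,G_2)$ the colored empirical measures $\overline\pi^\gamma_t=(\pi^\gamma_{1,t},\pi^\gamma_{2,t})$ satisfy $$\langle\overline\pi^\gamma_t,\overline G\rangle=\sum_{i=1,2}\gamma^d\sum_{x\in\Lambda_\gamma}\alpha_i(x)\sigma_t(x)G_i(\gamma x).$$ **Theorem.** Let $m_0:\Lambda\to[-1,1]$ be continuous, and let $(\sigma^\gamma)_\gamma$ be deterministic configurations (not depending on $\alpha$) such that $\gamma^d\sum_{x\in\Lambda_\gamma}\sigma^\gamma(x)\delta_{\gamma x}$ converges weakly to $m_0(r)\,dr$ as $\gamma\to0$, i.e. when tested against every continuous function on $\Lambda$. Then there is a unique curve $\overline m^{\overline V}=(m_1,m_2)\in C([0,T],L^\infty(\Lambda))^2$, differentiable in time, that solves, for $i=1,2$ and with $m=m_1+m_2$, $(J*m)(t,r)=\int_\Lambda J(r-r')m(t,r')\,dr'$, $$\partial_t m_i(t,r)=\Big\{-m_i(t,r)+p_i\tanh\big[(J*m)(t,r)+a_i\theta+2V_i(t,r)\big]\Big\}\,\frac{\cosh\big[(J*m)(t,r)+a_i\theta+2V_i(t,r)\big]}{\cosh\big[(J*m)(t,r)+a_i\theta\big]},\qquad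 m_i(0,\cdot)=p_im_0 ;$$ and, for $\mathbb P$-almost every $\alpha$, for all $t\in[0,T]$, all $\overline G=(G_1,G_2)\in C^1(\Lambda)^2$ and all $\delta>0$, $$\lim_{\gamma\to0}P^{\overline V,\gamma,\alpha}_{\sigma^\gamma}\Big[\Big|\langle\overline\pi^\gamma_t,\overline G\rangle-\sum_{i=1,2}\int_\Lambda G_i(r)\,m_i(t,r)\,dr\Big|\ge\delta\Big]=0 .$$ -/

import Mathlib

open MeasureTheory ProbabilityTheory Filter Topology Set
open scoped ENNReal

namespace KacGlauber

noncomputable section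

/-- The `d`-dimensional torus of side length one; its `volume` is Lebesgue measure. -/
abbrev Torus (d : ℕ) := Fin d → UnitAddCircle

/-- Continuously differentiable functions on the torus: the periodic lift to `ℝ ^ d` is `C ^ 1`. -/
def IsC1 {d : ℕ} (G : Torus d → ℝ) : Prop :=
  ContDiff ℝ 1 (fun u : Fin d → ℝ => G (fun j => (u j : UnitAddCircle)))

/-- Functions on `[0, T] × Λ` that are jointly continuous and have a jointly continuous
time derivative (one-sided at the end points). -/
def IsC10 {d : ℕ} (T : ℝ) (V : ℝ → Torus d → ℝ) : Prop :=
  ContinuousOn (Function.uncurry V) (Icc 0 T ×ˢ univ) ∧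
  ∃ V' : ℝ → Torus d → ℝ, ContinuousOn (Function.uncurry V') (Icc 0 T ×ˢ univ) ∧
    ∀ t ∈ Icc 0 T, ∀ r, HasDerivWithinAt (fun s => V s r) (V' t r) (Icc 0 T) t

/-! ### Configurations -/

/-- The discrete torus `ℤ ^ d / n ℤ ^ d`, where `n = γ⁻¹`. -/
abbrev Site (d n : ℕ) := Fin d → ZMod n

/-- Spin configurations; `ℤˣ = {1, -1}`. -/
abbrev Config (d n : ℕ) := Site d n → ℤˣ

/-- The real value `σ(x) ∈ {-1, 1}` of the spin at `x`. -/
def spin {d n : ℕ} (σ : Config d n) (x : Site d n) : ℝ := ((σ x : ℤ) : ℝ)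

/-- The configuration obtained from `σ` by flipping the spin at `x`. -/
def flipAt {d n : ℕ} (σ : Config d n) (x : Site d n) : Config d n :=
  Function.update σ x (-σ x)

/-- The macroscopic point `γ x = x / n` of the unit torus. -/
def scalePt {d n : ℕ} [NeZero n] (x : Site d n) : Torus d :=
  fun j => ZMod.toAddCircle (x j)

/-- The random field on the discrete torus induced by the field `α` on `ℤ ^ d`: the value at `x` is
the value at the representative of `x` closest to the origin. For `n = 2 k + 1` the representatives
are the points of `{-k, …, k} ^ d`. -/
def field {d n : ℕ} (α : (Fin d → ℤ) → ℝ) (x : Site d n) : ℝ :=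
  α (fun j => (x j).valMinAbs)

open scoped Classical in
/-- The indicator `α_i(x)` of the event that the field at `x` has the value `a i`. -/
def colour {d n : ℕ} (a : Fin 2 → ℝ) (α : (Fin d → ℤ) → ℝ) (i : Fin 2) (x : Site d n) : ℝ :=
  if field α x = a i then 1 else 0

/-- The pairing of the empirical measure `γ ^ d ∑ x, σ(x) δ_{γ x}` with the function `G`. -/
def empirical {d n : ℕ} [NeZero n] (σ : Config d n) (G : Torus d → ℝ) : ℝ :=
  ((n : ℝ)⁻¹) ^ d * ∑ x, spin σ x * G (scalePt x)

/-- The pairing of the coloured empirical measures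
`π_i = γ ^ d ∑ x, α_i(x) σ(x) δ_{γ x}`, `i = 1, 2`, with the pair of functions `G`. -/
def colouredEmpirical {d n : ℕ} [NeZero n] (a : Fin 2 → ℝ) (α : (Fin d → ℤ) → ℝ)
    (σ : Config d n) (G : Fin 2 → Torus d → ℝ) : ℝ :=
  ∑ i, ((n : ℝ)⁻¹) ^ d * ∑ x, colour a α i x * spin σ x * G i (scalePt x)

/-! ### Energy, rates and the perturbed generator -/

/-- The Hamiltonian with Kac interaction `γ ^ d J(γ (x - y))` and random field `θ α`. -/
def hamiltonian {d n : ℕ} [NeZero n] (J : Torus d → ℝ) (θ : ℝ) (α : (Fin d → ℤ) → ℝ)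
    (σ : Config d n) : ℝ :=
  -(1 / 2) * ∑ x : Site d n, ∑ y : Site d n,
      ((n : ℝ)⁻¹) ^ d * J (scalePt (x - y)) * spin σ x * spin σ y
    - θ * ∑ x : Site d n, field α x * spin σ x

/-- The Glauber rate of a spin flip at `x` (inverse temperature one). -/
def rate {d n : ℕ} [NeZero n] (J : Torus d → ℝ) (θ : ℝ) (α : (Fin d → ℤ) → ℝ)
    (x : Site d n) (σ : Config d n) : ℝ :=
  Real.exp (-(1 / 2) * (hamiltonian J θ α (flipAt σ x) - hamiltonian J θ α σ)) /
    (2 * Real.cosh ((1 / 2) * (hamiltonian J θ α (flipAt σ x) - hamiltonian J θ α σ)))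

/-- The random external potential `V(t, γ x, α(x)) = ∑ i, α_i(x) V_i(t, γ x)`. -/
def potential {d n : ℕ} [NeZero n] (a : Fin 2 → ℝ) (V : Fin 2 → ℝ → Torus d → ℝ)
    (α : (Fin d → ℤ) → ℝ) (t : ℝ) (x : Site d n) : ℝ :=
  ∑ i, colour a α i x * V i t (scalePt x)

/-- The time dependent perturbed rate. -/
def perturbedRate {d n : ℕ} [NeZero n] (J : Torus d → ℝ) (θ : ℝ) (a : Fin 2 → ℝ)
    (V : Fin 2 → ℝ → Torus d → ℝ) (α : (Fin d → ℤ) → ℝ)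
    (x : Site d n) (σ : Config d n) (t : ℝ) : ℝ :=
  Real.exp (-(spin σ x * (2 * potential a V α t x))) * rate J θ α x σ

/-- The generator at time `t` of the perturbed dynamics. -/
def generator {d n : ℕ} [NeZero n] (J : Torus d → ℝ) (θ : ℝ) (a : Fin 2 → ℝ)
    (V : Fin 2 → ℝ → Torus d → ℝ) (α : (Fin d → ℤ) → ℝ) (t : ℝ)
    (f : Config d n → ℝ) (σ : Config d n) : ℝ :=
  ∑ x, perturbedRate J θ a V α x σ t * (f (flipAt σ x) - f σ)

/-! ### Path space and the law of the process -/

/-- The space `D([0, T], {-1, 1} ^ Λ_γ)` of right continuous paths with left limits, for the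
discrete topology on configurations. As a subtype of a product it carries the σ-algebra generated
by the coordinate maps. -/
abbrev PathSpace (d n : ℕ) (T : ℝ) :=
  {w : Icc (0 : ℝ) T → Config d n //
    ∀ t, (∀ᶠ s in 𝓝[>] t, w s = w t) ∧ ∃ η, ∀ᶠ s in 𝓝[<] t, w s = η}

/-- The canonical filtration, generated at time `t` by the coordinates up to time `t`. -/
def canonicalFiltration (d n : ℕ) (T : ℝ) :
    Filtration (Icc (0 : ℝ) T) (inferInstance : MeasurableSpace (PathSpace d n T)) where
  seq t := ⨆ s : Iic t, MeasurableSpace.comap (fun w : PathSpace d n T => w.1 s) inferInstance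
  mono' := fun _ _ hst => iSup_le fun u =>
    le_iSup (fun v : Iic _ => MeasurableSpace.comap (fun w : PathSpace d n T => w.1 v) inferInstance)
      ⟨u.1, le_trans u.2 hst⟩
  le' := fun _ => iSup_le fun u =>
    ((measurable_pi_apply u.1).comp measurable_subtype_coe).comap_le

/-- `Q` is the law on path space of the perturbed Glauber process started from `σ₀`: it is a
probability measure that solves the martingale problem of the time dependent generator. -/
def IsGlauberLaw {d n : ℕ} [NeZero n] (J : Torus d → ℝ) (θ : ℝ) (a : Fin 2 → ℝ)
    (V : Fin 2 → ℝ → Torus d → ℝ) (α : (Fin d → ℤ) → ℝ) {T : ℝ} (hT : 0 ≤ T)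
    (σ₀ : Config d n) (Q : Measure (PathSpace d n T)) : Prop :=
  IsProbabilityMeasure Q ∧
  (∀ᵐ w ∂Q, w.1 ⟨0, left_mem_Icc.2 hT⟩ = σ₀) ∧
  ∀ f : Config d n → ℝ,
    Martingale
      (fun (t : Icc (0 : ℝ) T) (w : PathSpace d n T) =>
        f (w.1 t) - f (w.1 ⟨0, left_mem_Icc.2 hT⟩)
          - ∫ s in (0 : ℝ)..(t : ℝ), generator J θ a V α s f (w.1 (projIcc 0 T hT s)))
      (canonicalFiltration d n T) Q

/-! ### The limiting equation -/

/-- The convolution `(J * u)(r) = ∫ J(r - r') u(r') dr'` on the torus. -/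
def torusConv {d : ℕ} (J u : Torus d → ℝ) (r : Torus d) : ℝ := ∫ r', J (r - r') * u r'

/-- The right-hand side of the perturbed equation for the colour `i`, at the pair of profiles `u`
and with `v = V_i(t, ·)`. -/
def drift {d : ℕ} (J : Torus d → ℝ) (θ : ℝ) (a p : Fin 2 → ℝ) (i : Fin 2)
    (v : Torus d → ℝ) (u : Fin 2 → Torus d → ℝ) (r : Torus d) : ℝ :=
  (-u i r + p i * Real.tanh (torusConv J (fun r' => u 0 r' + u 1 r') r + a i * θ + 2 * v r)) *
    (Real.cosh (torusConv J (fun r' => u 0 r' + u 1 r') r + a i * θ + 2 * v r) /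
      Real.cosh (torusConv J (fun r' => u 0 r' + u 1 r') r + a i * θ))

/-- `m = (m_1, m_2)` is a solution on `[0, T]` of the perturbed equation with initial condition
`m_i(0, ·) = p_i m₀`. It is a curve in `L^∞(Λ)`, differentiable in time for the norm of `L^∞(Λ)`
(hence continuous); only its values for `t ∈ [0, T]` matter. -/
def IsSolution {d : ℕ} (J : Torus d → ℝ) (θ : ℝ) (a p : Fin 2 → ℝ)
    (V : Fin 2 → ℝ → Torus d → ℝ) (T : ℝ) (m₀ : Torus d → ℝ)
    (m : Fin 2 → ℝ → Lp ℝ ∞ (volume : Measure (Torus d))) : Prop :=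
  (∀ i, m i 0 =ᵐ[volume] fun r => p i * m₀ r) ∧
  ∀ i, ∀ t ∈ Icc 0 T, ∃ D : Lp ℝ ∞ (volume : Measure (Torus d)),
    (D =ᵐ[volume] drift J θ a p i (V i t) (fun j => (m j t : Torus d → ℝ))) ∧
    HasDerivWithinAt (m i) D (Icc 0 T) t

end

end KacGlauber

open KacGlauber

namespace KacGlauber

/-! The spins are compared with a deterministic profile on the lattice, and that profile with the
limit. Let `u` be a continuous solution of the limiting equation and freeze its field `J * (u 0 + u
1) + a i * θ`. Along this field the equation of each colour is linear, `f' = force - f * relax`, so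
its solution from the value `z` is affine in `z`: `z * D + S` (`IsCharacteristic`). The choice `z =
m₀ r`, multiplied by `p i`, gives back `u`; the choice `z = σ₀(x)` at each site gives `siteProfile`,
which has no initial error at all.

For a weight `g` with `|g| ≤ 1` let `Y_g` be the lattice average of `g` times spin minus profile. A
spin has drift `force - σ * relax` at its microscopic field (`perturbedRate_eq`). Subtracting the
drift of the profile leaves two terms. Relaxation gives `Y_{g'}` with `g' = g * relax`, a bounded
nonrandom weight. The error in the field is, up to something small, the deviation with weight `J(γ(x
- ·))`, because the Kac interaction sees the configuration only through averages. Jumps add a term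
of order `n⁻ᵈ`. Hence the supremum over `g` of the second moments of `Y_g`, taken outside the
expectation, satisfies a closed Gronwall inequality (`drift_deviation_sq_le`, `family_gronwall`,
`IsGlauberLaw.deviation_sq_le`), and Chebyshev's inequality concludes this half.

It remains to average the profile. Since it is affine in `σ₀(x)`, its coloured averages at any time
are averages at time zero of `α_i σ₀ φ` and `α_i φ`. As `σ₀` does not depend on the disorder,
Hoeffding's inequality and Borel–Cantelli replace `α_i` by `p i`. Separability of the continuous
functions gives one null set for all `φ`, and compactness gives uniformity over times and translates
of `J` (`ae_forall_tendsto_colouredError`, `eventually_profileError_translates_le`).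

The limiting equation is solved with a truncated state, for which the vector field is bounded and
Lipschitz; the bound `|force| ≤ relax` shows that the truncation is never active. Uniqueness is a
Gronwall argument in `L^∞`. -/

lemma IsC1.continuous {d : ℕ} {G : Torus d → ℝ} (hG : IsC1 G) : Continuous G := by
  -- Continuity of the periodic lift descends because the covering map is a quotient map.
  have hq : IsOpenQuotientMap
      (Pi.map (fun (_ : Fin d) (u : ℝ) => (u : UnitAddCircle))) :=
    IsOpenQuotientMap.piMap fun _ => QuotientAddGroup.isOpenQuotientMap_mk
  exact hq.isQuotientMap.continuous_iff.2 (ContDiff.continuous hG)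

instance : IsProbabilityMeasure (volume : Measure UnitAddCircle) :=
  ⟨UnitAddCircle.measure_univ⟩

/-! ### Lattice averages and Riemann sums on the torus. -/

section Lattice

variable {d n : ℕ} [NeZero n]

lemma scalePt_sub (x y : Site d n) : scalePt (x - y) = scalePt x - scalePt y := by
  funext j; simp [scalePt]

lemma scalePt_zero : scalePt (0 : Site d n) = 0 := by
  funext j; simp [scalePt]

/-- Every point of the torus lies within `1 / n` of a lattice point. -/
lemma exists_dist_scalePt_le (r : Torus d) :
    ∃ x : Site d n, dist r (scalePt x) ≤ (n : ℝ)⁻¹ := by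
  have hn : (0 : ℝ) < n := Nat.cast_pos.2 (NeZero.pos n)
  have key : ∀ s : UnitAddCircle, ∃ z : ZMod n, dist s (ZMod.toAddCircle z) ≤ (n : ℝ)⁻¹ := by
    intro s
    obtain ⟨u, rfl⟩ := QuotientAddGroup.mk_surjective s
    refine ⟨((⌊n * u⌋ : ℤ) : ZMod n), ?_⟩
    rw [ZMod.toAddCircle_intCast, dist_eq_norm, ← QuotientAddGroup.mk_sub]
    refine (AddCircle.norm_eq (p := 1) (x := u - ⌊n * u⌋ / n)).le.trans ?_
    have h1 : |u - ⌊n * u⌋ / n| ≤ (n : ℝ)⁻¹ := by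
      have := Int.floor_le (n * u)
      have := Int.lt_floor_add_one (n * u)
      have e : u - ⌊n * u⌋ / n = (n * u - ⌊n * u⌋) * (n : ℝ)⁻¹ := by field_simp
      rw [e, abs_mul, abs_of_nonneg (by linarith), abs_of_pos (inv_pos.2 hn)]
      exact mul_le_of_le_one_left (inv_pos.2 hn).le (by linarith)
    have h2 := round_le (u - ⌊n * u⌋ / n) 0
    simp only [inv_one, one_mul, mul_one]
    simp only [Int.cast_zero, sub_zero] at h2
    exact h2.trans h1
  choose f hf using key
  refine ⟨fun j => f (r j), (dist_pi_le_iff (inv_pos.2 hn).le).2 fun j => hf (r j)⟩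

/-- The average of a function over the lattice points. -/
noncomputable def siteAvg (f : Site d n → ℝ) : ℝ := ((n : ℝ)⁻¹) ^ d * ∑ x, f x

lemma card_site_inv : ((n : ℝ)⁻¹) ^ d = (Fintype.card (Site d n) : ℝ)⁻¹ := by
  simp [ZMod.card]

lemma siteAvg_const (c : ℝ) : siteAvg (fun _ : Site d n => c) = c := by
  have : (Fintype.card (Site d n) : ℝ) ≠ 0 := Nat.cast_ne_zero.2 Fintype.card_ne_zero
  simp only [siteAvg, card_site_inv, Finset.sum_const, Finset.card_univ, nsmul_eq_mul]
  field_simp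

lemma siteAvg_mono {f g : Site d n → ℝ} (h : ∀ x, f x ≤ g x) : siteAvg f ≤ siteAvg g :=
  mul_le_mul_of_nonneg_left (Finset.sum_le_sum fun x _ => h x) (by positivity)

lemma siteAvg_add (f g : Site d n → ℝ) :
    siteAvg (fun x => f x + g x) = siteAvg f + siteAvg g := by
  simp [siteAvg, Finset.sum_add_distrib, mul_add]

lemma siteAvg_sub (f g : Site d n → ℝ) :
    siteAvg (fun x => f x - g x) = siteAvg f - siteAvg g := by
  simp [siteAvg, Finset.sum_sub_distrib, mul_sub]

lemma siteAvg_mul_left (c : ℝ) (f : Site d n → ℝ) :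
    siteAvg (fun x => c * f x) = c * siteAvg f := by
  simp only [siteAvg, ← Finset.mul_sum]; ring

lemma abs_siteAvg_le (f : Site d n → ℝ) : |siteAvg f| ≤ siteAvg fun x => |f x| := by
  rw [siteAvg, siteAvg, abs_mul, abs_of_nonneg (by positivity)]
  gcongr
  exact Finset.abs_sum_le_sum_abs _ _

lemma abs_siteAvg_le_of_le {f : Site d n → ℝ} {c : ℝ} (h : ∀ x, |f x| ≤ c) :
    |siteAvg f| ≤ c :=
  (abs_siteAvg_le f).trans ((siteAvg_mono h).trans_eq (siteAvg_const c))

/-- The variance under the uniform law on the sites is nonnegative. -/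
lemma sq_siteAvg_le (f : Site d n → ℝ) : siteAvg f ^ 2 ≤ siteAvg fun x => f x ^ 2 := by
  have h : 0 ≤ siteAvg fun x => (f x - siteAvg f) ^ 2 := by
    refine (siteAvg_const (d := d) (n := n) 0).symm.le.trans (siteAvg_mono fun x => sq_nonneg _)
  have e : (fun x => (f x - siteAvg f) ^ 2) =
      fun x => (f x ^ 2 - (2 * siteAvg f) * f x) + siteAvg f ^ 2 := by
    funext x; ring
  rw [e, siteAvg_add, siteAvg_sub, siteAvg_mul_left, siteAvg_const] at h
  nlinarith

/-- Riemann sums of a function with a modulus of continuity at the scale of the lattice. -/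
lemma abs_siteAvg_sub_integral_le {φ : Torus d → ℝ} (hφ : Continuous φ) {ε : ℝ}
    (hε : ∀ r s, dist r s ≤ (n : ℝ)⁻¹ → |φ r - φ s| ≤ ε) :
    |siteAvg (fun x : Site d n => φ (scalePt x)) - ∫ r, φ r| ≤ ε := by
  -- `S` has the same integral as `φ` and is invariant under lattice translations. To compare `S 0`
  -- with `S r`, the point `r` can therefore be moved within distance `1 / n` of the origin.
  set S : Torus d → ℝ := fun r => siteAvg (fun x : Site d n => φ (r + scalePt x)) with hS
  have hcont : ∀ x : Site d n, Continuous fun r => φ (r + scalePt x) := fun x => by fun_prop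
  have hint : ∀ x : Site d n, Integrable fun r => φ (r + scalePt x) := fun x =>
    (hcont x).integrable_of_hasCompactSupport (HasCompactSupport.of_compactSpace _)
  have hSint : ∫ r, S r = ∫ r, φ r := by
    simp only [hS, siteAvg]
    rw [integral_const_mul, integral_finsetSum _ fun x _ => hint x]
    have : ∀ x : Site d n, ∫ r, φ (r + scalePt x) = ∫ r, φ r := fun x =>
      integral_add_right_eq_self φ (scalePt x)
    simp only [this]
    exact siteAvg_const (d := d) (n := n) (∫ r, φ r)
  have hper : ∀ r (z : Site d n), S (r - scalePt z) = S r := by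
    intro r z
    simp only [hS, siteAvg]
    congr 1
    refine (Equiv.sum_comp (Equiv.subRight z) fun x => φ (r + scalePt x)).symm.trans ?_ |>.symm
    refine Finset.sum_congr rfl fun x _ => ?_
    simp only [Equiv.subRight_apply, scalePt_sub]
    congr 1; abel
  have hbd : ∀ r, |S 0 - S r| ≤ ε := by
    intro r
    obtain ⟨z, hz⟩ := exists_dist_scalePt_le (n := n) r
    rw [← hper r z]
    simp only [hS, ← siteAvg_sub]
    refine abs_siteAvg_le_of_le fun x => hε _ _ ?_
    rw [dist_add_right, dist_comm, dist_zero_right, ← dist_eq_norm]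
    exact hz
  have e : siteAvg (fun x : Site d n => φ (scalePt x)) - ∫ r, φ r = ∫ r, (S 0 - S r) := by
    have hSi : Integrable S :=
      (integrable_finsetSum _ fun x _ => hint x).const_mul _
    rw [integral_sub (integrable_const _) hSi, hSint]
    simp [hS]
  rw [e]
  simpa using norm_integral_le_of_norm_le_const (μ := volume) (f := fun r => S 0 - S r)
    (ae_of_all _ hbd)

end Lattice

lemma tendsto_siteAvg {d : ℕ} {φ : Torus d → ℝ} (hφ : Continuous φ) :
    Tendsto (fun k => siteAvg (fun x : Site d (2 * k + 1) => φ (scalePt x))) atTop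
      (𝓝 (∫ r, φ r)) := by
  rw [Metric.tendsto_atTop]
  intro ε hε
  obtain ⟨δ, hδ, h⟩ := Metric.uniformContinuous_iff.1
    (CompactSpace.uniformContinuous_of_continuous hφ) (ε / 2) (half_pos hε)
  obtain ⟨N, hN⟩ := exists_nat_gt (δ⁻¹)
  refine ⟨N, fun k hk => lt_of_le_of_lt (abs_siteAvg_sub_integral_le hφ (ε := ε / 2) ?_)
    (half_lt_self hε)⟩
  intro r s hrs
  refine (h (lt_of_le_of_lt hrs ?_)).le
  rw [inv_lt_comm₀ (by positivity) hδ]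
  refine hN.trans_le ?_
  have : (N : ℝ) ≤ k := Nat.cast_le.2 hk
  push_cast
  have : (0 : ℝ) ≤ k := by positivity
  linarith

/-! ### Coefficients of the one-spin dynamics and truncation. -/

section Rates

/-- The relaxation rate `cosh (h + 2 v) / cosh h`. -/
noncomputable def relax (v h : ℝ) : ℝ := Real.cosh (2 * v) + Real.tanh h * Real.sinh (2 * v)

/-- The forcing `sinh (h + 2 v) / cosh h`. -/
noncomputable def force (v h : ℝ) : ℝ := Real.tanh h * Real.cosh (2 * v) + Real.sinh (2 * v)

/-- By the addition formulas both coefficients are affine in `tanh h`, so their bounds and Lipschitz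
constants in `h` depend on `v` alone. -/
lemma cosh_div_cosh (v h : ℝ) : Real.cosh (h + 2 * v) / Real.cosh h = relax v h := by
  have := (Real.cosh_pos h).ne'
  rw [relax, Real.tanh_eq_sinh_div_cosh, Real.cosh_add]
  field_simp

lemma sinh_div_cosh (v h : ℝ) : Real.sinh (h + 2 * v) / Real.cosh h = force v h := by
  have := (Real.cosh_pos h).ne'
  rw [force, Real.tanh_eq_sinh_div_cosh, Real.sinh_add]
  field_simp

lemma tanh_mul_cosh_div_cosh (v h : ℝ) :
    Real.tanh (h + 2 * v) * (Real.cosh (h + 2 * v) / Real.cosh h) = force v h := by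
  have := (Real.cosh_pos (h + 2 * v)).ne'
  rw [← sinh_div_cosh, Real.tanh_eq_sinh_div_cosh]
  field_simp

lemma relax_pos (v h : ℝ) : 0 < relax v h := by
  rw [← cosh_div_cosh]; exact div_pos (Real.cosh_pos _) (Real.cosh_pos _)

/-- `force` is `tanh (h + 2 * v)` times `relax`. This is what confines the solution of colour `i` to
`[-p i, p i]`. -/
lemma abs_force_le_relax (v h : ℝ) : |force v h| ≤ relax v h := by
  rw [← tanh_mul_cosh_div_cosh, abs_mul, cosh_div_cosh, abs_of_pos (relax_pos v h)]
  exact mul_le_of_le_one_left (relax_pos v h).le (Real.abs_tanh_lt_one _).le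

/-- The expression is a convex combination of `exp (2 * v)` and `exp (-(2 * v))`. -/
lemma cosh_sub_mul_sinh_mem {v c s : ℝ} (hv : |v| ≤ c) (hs : |s| ≤ 1) :
    |Real.cosh (2 * v) - s * Real.sinh (2 * v)| ≤ Real.exp (2 * c) := by
  obtain ⟨h1, h2⟩ := abs_le.1 hs
  obtain ⟨h3, h4⟩ := abs_le.1 hv
  have e1 : Real.cosh (2 * v) - s * Real.sinh (2 * v) =
      (1 - s) / 2 * Real.exp (2 * v) + (1 + s) / 2 * Real.exp (-(2 * v)) := by
    rw [Real.cosh_eq, Real.sinh_eq]; ring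
  have p1 : Real.exp (2 * v) ≤ Real.exp (2 * c) := Real.exp_le_exp.2 (by linarith)
  have p2 : Real.exp (-(2 * v)) ≤ Real.exp (2 * c) := Real.exp_le_exp.2 (by linarith)
  have q1 := Real.exp_pos (2 * v)
  have q2 := Real.exp_pos (-(2 * v))
  rw [e1, abs_of_nonneg (by
    have : 0 ≤ (1 - s) / 2 := by linarith
    have : 0 ≤ (1 + s) / 2 := by linarith
    positivity)]
  nlinarith

lemma relax_le {v c : ℝ} (hv : |v| ≤ c) (h : ℝ) : relax v h ≤ Real.exp (2 * c) := by
  have := cosh_sub_mul_sinh_mem (s := -Real.tanh h) hv (by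
    rw [abs_neg]; exact (Real.abs_tanh_lt_one h).le)
  rw [neg_mul, sub_neg_eq_add] at this
  exact (le_abs_self _).trans this

lemma abs_force_le {v c : ℝ} (hv : |v| ≤ c) (h : ℝ) : |force v h| ≤ Real.exp (2 * c) :=
  (abs_force_le_relax v h).trans (relax_le hv h)

lemma abs_tanh_sub_le (x y : ℝ) : |Real.tanh x - Real.tanh y| ≤ |x - y| := by
  have hd : ∀ z : ℝ, HasDerivAt Real.tanh (1 / Real.cosh z ^ 2) z := by
    intro z
    have hz := (Real.cosh_pos z).ne'
    have h := (Real.hasDerivAt_sinh z).div (Real.hasDerivAt_cosh z) hz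
    have e : (Real.sinh / Real.cosh) = Real.tanh := by
      funext w; simp [Real.tanh_eq_sinh_div_cosh]
    rw [e] at h
    refine h.congr_deriv ?_
    rw [← Real.cosh_sq_sub_sinh_sq z]; ring
  have := Convex.norm_image_sub_le_of_norm_hasDerivWithin_le (f := Real.tanh) (C := 1) (s := univ)
    (fun z _ => (hd z).hasDerivWithinAt) (fun z _ => by
      rw [Real.norm_eq_abs, abs_of_nonneg (by positivity), div_le_one (by positivity)]
      nlinarith [Real.one_le_cosh z]) convex_univ (mem_univ y) (mem_univ x)
  simpa using this

lemma continuous_tanh : Continuous Real.tanh :=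
  (LipschitzWith.of_dist_le_mul (K := 1) fun x y => by
    simpa [Real.dist_eq] using abs_tanh_sub_le x y).continuous

lemma continuous_relax : Continuous fun q : ℝ × ℝ => relax q.1 q.2 := by
  have := continuous_tanh
  unfold relax; fun_prop

lemma continuous_force : Continuous fun q : ℝ × ℝ => force q.1 q.2 := by
  have := continuous_tanh
  unfold force; fun_prop

/-- The dependence of the drift of a single spin on the field. -/
lemma abs_force_sub_mul_relax_sub_le {v c s : ℝ} (hv : |v| ≤ c) (hs : |s| ≤ 1) (h h' : ℝ) :
    |(force v h - s * relax v h) - (force v h' - s * relax v h')|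
      ≤ Real.exp (2 * c) * |h - h'| := by
  have e : (force v h - s * relax v h) - (force v h' - s * relax v h') =
      (Real.cosh (2 * v) - s * Real.sinh (2 * v)) * (Real.tanh h - Real.tanh h') := by
    unfold force relax; ring
  rw [e, abs_mul]
  exact mul_le_mul (cosh_sub_mul_sinh_mem hv hs) (abs_tanh_sub_le h h') (abs_nonneg _)
    (Real.exp_pos _).le

/-- The scalar right-hand side of the limiting equation. -/
noncomputable def scalarDrift (q v h x : ℝ) : ℝ := -x * relax v h + q * force v h

/-- Only one of the two states has to lie in `[-1, 1]`. In the uniqueness proof this is the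
continuous solution, so no a priori bound on its competitor is needed. -/
lemma abs_scalarDrift_sub_le {q v c x : ℝ} (hv : |v| ≤ c) (hq : q ∈ Icc (0 : ℝ) 1) (hx : |x| ≤ 1)
    (h h' x' : ℝ) :
    |scalarDrift q v h' x' - scalarDrift q v h x|
      ≤ Real.exp (2 * c) * (|x' - x| + 2 * |h' - h|) := by
  -- The change of `x * relax` with the field is half the difference of the bounds for `s = x` and
  -- `s = -x`.
  have e : scalarDrift q v h' x' - scalarDrift q v h x =
      -(x' - x) * relax v h' + (1 / 2 * ((force v h' - x * relax v h') - (force v h - x * relax v h))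
        - 1 / 2 * ((force v h' - (-x) * relax v h') - (force v h - (-x) * relax v h)))
      + q * ((force v h' - 0 * relax v h') - (force v h - 0 * relax v h)) := by
    unfold scalarDrift; ring
  have b0 : |-(x' - x) * relax v h'| ≤ Real.exp (2 * c) * |x' - x| := by
    rw [abs_mul, abs_neg, abs_of_pos (relax_pos v h'), mul_comm]
    exact mul_le_mul_of_nonneg_right (relax_le hv h') (abs_nonneg _)
  have b1 := abs_force_sub_mul_relax_sub_le hv hx h' h
  have b2 := abs_force_sub_mul_relax_sub_le hv (by rwa [abs_neg] : |-x| ≤ 1) h' h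
  have b3 := abs_force_sub_mul_relax_sub_le hv (by simp : |(0 : ℝ)| ≤ 1) h' h
  have b4 : |q * ((force v h' - 0 * relax v h') - (force v h - 0 * relax v h))|
      ≤ Real.exp (2 * c) * |h' - h| := by
    rw [abs_mul, abs_of_nonneg hq.1]
    exact (mul_le_of_le_one_left (abs_nonneg _) hq.2).trans b3
  rw [e]
  rw [abs_le] at b0 b1 b2 b4 ⊢
  constructor <;> linarith [b0.1, b0.2, b1.1, b1.2, b2.1, b2.2, b4.1, b4.2]

/-- Truncation of a real number to `[-1, 1]`. -/
def clip (x : ℝ) : ℝ := max (-1) (min x 1)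

lemma abs_clip_le (x : ℝ) : |clip x| ≤ 1 :=
  abs_le.2 ⟨le_max_left _ _, max_le (by norm_num) (min_le_right _ _)⟩

lemma clip_of_abs_le {x : ℝ} (hx : |x| ≤ 1) : clip x = x := by
  obtain ⟨h1, h2⟩ := abs_le.1 hx
  rw [clip, min_eq_left h2, max_eq_right h1]

lemma clip_neg (x : ℝ) : clip (-x) = -clip x := by
  simp only [clip, min_def, max_def]
  split_ifs <;> linarith

lemma abs_clip_sub_le (x y : ℝ) : |clip x - clip y| ≤ |x - y| :=
  (abs_max_sub_max_le_max (-1) (min x 1) (-1) (min y 1)).trans (by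
    simpa using abs_min_sub_min_le_max x 1 y 1)

@[fun_prop]
lemma continuous_clip : Continuous clip := by unfold clip; fun_prop

end Rates

/-! ### Ordinary differential equations: invariant intervals and global existence. -/

lemma hasDerivWithinAt_Ici_of_Icc {E : Type*} [NormedAddCommGroup E] [NormedSpace ℝ E]
    {f : ℝ → E} {f' : E} {a b t : ℝ} (h : HasDerivWithinAt f f' (Icc a b) t) (ht : t ∈ Ico a b) :
    HasDerivWithinAt f f' (Ici t) t :=
  h.mono_of_mem_nhdsWithin (Icc_mem_nhdsGE_of_mem ht)

/-- Solutions of a linear relaxation equation with truncated state do not leave `[-q, q]`. -/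
lemma le_of_clipped_relaxation {T q : ℝ} (hq : q ∈ Icc (0 : ℝ) 1) {f A b : ℝ → ℝ}
    (hA : ∀ t ∈ Icc 0 T, 0 < A t) (hb : ∀ t ∈ Icc 0 T, |b t| ≤ q * A t) (h0 : f 0 ≤ q)
    (hf : ∀ t ∈ Icc 0 T, HasDerivWithinAt f (-clip (f t) * A t + b t) (Icc 0 T) t) :
    ∀ t ∈ Icc 0 T, f t ≤ q := by
  intro t ht
  refine le_of_forall_pos_le_add fun ε hε => ?_
  have hε' : 0 < ε / (1 + t) := div_pos hε (by linarith [ht.1])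
  -- The barrier has positive slope and ends at `q + ε`. Where `f` meets it, `f ≥ q`, hence `clip (f
  -- s) ≥ q` because `q ≤ 1`, and the derivative of `f` is at most `-q * A + q * A = 0`, strictly
  -- below the slope.
  have key := image_le_of_deriv_right_lt_deriv_boundary
    (f' := fun s => -clip (f s) * A s + b s) (B := fun s => q + ε / (1 + t) * (1 + s)) (B' := fun _ => ε / (1 + t))
    (fun s hs => (hf s hs).continuousWithinAt)
    (fun s hs => hasDerivWithinAt_Ici_of_Icc (hf s (Ico_subset_Icc_self hs)) hs) (by simpa using h0.trans (le_add_of_nonneg_right hε'.le))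
    (fun s => by simpa using (((hasDerivAt_id s).const_add 1).const_mul (ε / (1 + t))).const_add q)
    (fun s hs hfs => by
      have hs' := Ico_subset_Icc_self hs
      have hcl : q ≤ clip (f s) := by
        refine le_max_of_le_right (le_min ?_ hq.2)
        rw [hfs]
        have : 0 ≤ ε / (1 + t) * (1 + s) := mul_nonneg hε'.le (by linarith [hs.1])
        linarith
      have h1 := (abs_le.1 (hb s hs')).2
      have h2 := mul_le_mul_of_nonneg_right hcl (hA s hs').le
      linarith) ht
  have e : ε / (1 + t) * (1 + t) = ε := div_mul_cancel₀ _ (by linarith [ht.1])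
  simpa only [e] using key

lemma abs_le_of_clipped_relaxation {T q : ℝ} (hq : q ∈ Icc (0 : ℝ) 1) {f A b : ℝ → ℝ}
    (hA : ∀ t ∈ Icc 0 T, 0 < A t) (hb : ∀ t ∈ Icc 0 T, |b t| ≤ q * A t) (h0 : |f 0| ≤ q)
    (hf : ∀ t ∈ Icc 0 T, HasDerivWithinAt f (-clip (f t) * A t + b t) (Icc 0 T) t) :
    ∀ t ∈ Icc 0 T, |f t| ≤ q := by
  intro t ht
  refine abs_le.2 ⟨neg_le.1 ?_, le_of_clipped_relaxation hq hA hb (abs_le.1 h0).2 hf t ht⟩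
  refine le_of_clipped_relaxation (f := fun s => -f s) (b := fun s => -b s) hq hA
    (by simpa using hb) (neg_le.1 (abs_le.1 h0).1) (fun s hs => ?_) t ht
  refine (hf s hs).neg.congr_deriv ?_
  rw [clip_neg]; ring

/-- Global solvability of an ordinary differential equation in a space of continuous functions
whose right-hand side acts pointwise, is bounded and is Lipschitz. -/
lemma exists_solution_of_bounded_lipschitz {X ι : Type*} [TopologicalSpace X] [CompactSpace X]
    [Fintype ι] {T : ℝ} (hT : 0 ≤ T) (Ψ : ι → ℝ → (ι → C(X, ℝ)) → X → ℝ)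
    (hc : ∀ i U, Continuous fun q : ℝ × X => Ψ i q.1 U q.2) {L K : ℝ} (hL : 0 ≤ L) (hK : 0 ≤ K)
    (hΨL : ∀ i t U r, |Ψ i t U r| ≤ L)
    (hΨK : ∀ i t U U' r, |Ψ i t U r - Ψ i t U' r| ≤ K * ‖U - U'‖) (U₀ : ι → C(X, ℝ)) :
    ∃ U : ι → ℝ → C(X, ℝ), (∀ i, U i 0 = U₀ i) ∧ ∀ i, ∀ t ∈ Icc 0 T,
      ∃ D : C(X, ℝ), (∀ r, D r = Ψ i t (fun j => U j t) r) ∧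
        HasDerivWithinAt (U i) D (Icc 0 T) t := by
  let F : ℝ → (ι → C(X, ℝ)) → ι → C(X, ℝ) := fun t U i =>
    ⟨Ψ i t U, (hc i U).comp (by fun_prop : Continuous fun r : X => (t, r))⟩
  -- With the global bound `L`, a ball of radius `L * T` cannot be left before time `T`, so one
  -- application of Picard–Lindelöf covers the whole interval.
  have hF : IsPicardLindelof F (⟨0, left_mem_Icc.2 hT⟩ : Icc 0 T) U₀
      (⟨L, hL⟩ * ⟨T, hT⟩) 0 ⟨L, hL⟩ ⟨K, hK⟩ := by
    refine ⟨fun t _ => ?_, fun U _ => ?_, fun t _ U _ => ?_, ?_⟩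
    · refine LipschitzWith.lipschitzOnWith (LipschitzWith.of_dist_le_mul fun U U' => ?_)
      have h0 : 0 ≤ K * ‖U - U'‖ := mul_nonneg hK (norm_nonneg _)
      rw [dist_eq_norm, dist_eq_norm]
      refine (pi_norm_le_iff_of_nonneg h0).2 fun i => (ContinuousMap.norm_le _ h0).2 fun r => ?_
      exact hΨK i t U U' r
    · refine (continuous_pi fun i => ?_).continuousOn
      exact (ContinuousMap.curry ⟨fun q : ℝ × X => Ψ i q.1 U q.2, hc i U⟩).continuous
    · refine (pi_norm_le_iff_of_nonneg hL).2 fun i => (ContinuousMap.norm_le _ hL).2 fun r => ?_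
      exact hΨL i t U r
    · simp only [sub_zero, sub_self, max_eq_left hT, NNReal.coe_zero]
      exact le_rfl
  obtain ⟨α, h0, hα⟩ := hF.exists_eq_forall_mem_Icc_hasDerivWithinAt₀
  refine ⟨fun i t => α t i, fun i => by rw [← h0], fun i t ht => ⟨F t (α t) i, fun r => rfl, ?_⟩⟩
  exact hasDerivWithinAt_pi.1 (hα t ht) i

/-! ### Convolution on the torus. -/

section Convolution

variable {d : ℕ} {J : Torus d → ℝ}

lemma integrable_torus_of_continuous {f : Torus d → ℝ} (hf : Continuous f) : Integrable f :=
  hf.integrable_of_hasCompactSupport (HasCompactSupport.of_compactSpace _)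

lemma exists_abs_le {X : Type*} [TopologicalSpace X] [CompactSpace X] {f : X → ℝ}
    (hf : Continuous f) : ∃ j, 0 ≤ j ∧ ∀ r, |f r| ≤ j :=
  ⟨‖(⟨f, hf⟩ : C(X, ℝ))‖, norm_nonneg _, fun r =>
    ContinuousMap.norm_coe_le_norm (⟨f, hf⟩ : C(X, ℝ)) r⟩

lemma continuous_torusConv_param {X : Type*} [TopologicalSpace X] [FirstCountableTopology X]
    [LocallyCompactSpace X] (hJ : Continuous J) {u : X → Torus d → ℝ}
    (hu : Continuous (Function.uncurry u)) :
    Continuous fun q : X × Torus d => torusConv J (u q.1) q.2 := by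
  have h : Continuous (Function.uncurry fun (q : X × Torus d) (r' : Torus d) =>
      J (q.2 - r') * u q.1 r') := by
    have h2 : Continuous fun z : (X × Torus d) × Torus d => u z.1.1 z.2 :=
      hu.comp (by fun_prop : Continuous fun z : (X × Torus d) × Torus d => (z.1.1, z.2))
    simp only [Function.uncurry_def]
    fun_prop
  simpa [torusConv] using continuous_parametric_integral_of_continuous
    (μ := (volume : Measure (Torus d))) h isCompact_univ

lemma continuous_torusConv (hJ : Continuous J) {u : Torus d → ℝ} (hu : Continuous u) :
    Continuous (torusConv J u) :=
  (continuous_torusConv_param (X := Unit) hJ (u := fun _ => u)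
    (hu.comp continuous_snd)).comp (by fun_prop : Continuous fun r : Torus d => ((), r))

lemma abs_torusConv_sub_le {j c : ℝ} (hJ : Continuous J) (hj : ∀ r, |J r| ≤ j)
    {u u' : Torus d → ℝ} (hu : Integrable u) (hu' : Integrable u')
    (h : ∀ᵐ r, |u r - u' r| ≤ c) (r : Torus d) :
    |torusConv J u r - torusConv J u' r| ≤ j * c := by
  have hi : ∀ {w : Torus d → ℝ}, Integrable w → Integrable fun r' => J (r - r') * w r' :=
    fun hw => hw.bdd_mul (by fun_prop : Continuous fun r' => J (r - r')).aestronglyMeasurable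
      (ae_of_all _ fun r' => hj (r - r'))
  rw [torusConv, torusConv, ← integral_sub (hi hu) (hi hu')]
  have := norm_integral_le_of_norm_le_const (μ := (volume : Measure (Torus d)))
    (f := fun r' => J (r - r') * u r' - J (r - r') * u' r') (C := j * c) (by
      filter_upwards [h] with r' hr'
      rw [← mul_sub, Real.norm_eq_abs, abs_mul]
      exact mul_le_mul (hj _) hr' (abs_nonneg _) ((abs_nonneg _).trans (hj 0)))
  simpa using this

end Convolution

/-! ### Existence and uniqueness for the limiting equation. -/

section LimitEquation

variable {d : ℕ} {J : Torus d → ℝ} {θ : ℝ} {a p : Fin 2 → ℝ} {T : ℝ}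

/-- The field `J * (u 0 + u 1) + a i θ` felt by the spins of colour `i`. -/
noncomputable def localField (J : Torus d → ℝ) (θ : ℝ) (a : Fin 2 → ℝ) (i : Fin 2)
    (u : Fin 2 → Torus d → ℝ) (r : Torus d) : ℝ :=
  torusConv J (fun r' => u 0 r' + u 1 r') r + a i * θ

lemma drift_eq (i : Fin 2) (v : Torus d → ℝ) (u : Fin 2 → Torus d → ℝ) (r : Torus d) :
    drift J θ a p i v u r = scalarDrift (p i) (v r) (localField J θ a i u r) (u i r) := by
  rw [scalarDrift, ← tanh_mul_cosh_div_cosh, ← cosh_div_cosh, drift, localField]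
  ring

lemma abs_localField_sub_le {j c : ℝ} (hJ : Continuous J) (hj : ∀ r, |J r| ≤ j)
    {u u' : Fin 2 → Torus d → ℝ} (hu : ∀ i, Integrable (u i)) (hu' : ∀ i, Integrable (u' i))
    (h : ∀ i, ∀ᵐ r, |u i r - u' i r| ≤ c) (i : Fin 2) (r : Torus d) :
    |localField J θ a i u r - localField J θ a i u' r| ≤ j * (2 * c) := by
  simp only [localField, add_sub_add_right_eq_sub]
  refine abs_torusConv_sub_le hJ hj ((hu 0).add (hu 1)) ((hu' 0).add (hu' 1)) ?_ r
  filter_upwards [h 0, h 1] with r h0 h1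
  have e : u 0 r + u 1 r - (u' 0 r + u' 1 r) = (u 0 r - u' 0 r) + (u 1 r - u' 1 r) := by ring
  rw [Pi.add_apply, Pi.add_apply, e]
  linarith [abs_add_le (u 0 r - u' 0 r) (u 1 r - u' 1 r)]

/-- A curve of pairs of continuous profiles that solves the limiting equation. -/
structure IsContinuousSolution (J : Torus d → ℝ) (θ : ℝ) (a p : Fin 2 → ℝ)
    (V : Fin 2 → ℝ → Torus d → ℝ) (T : ℝ) (m₀ : Torus d → ℝ)
    (u : Fin 2 → ℝ → C(Torus d, ℝ)) : Prop where
  init : ∀ i r, u i 0 r = p i * m₀ r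
  bound : ∀ i, ∀ t ∈ Icc 0 T, ∀ r, |u i t r| ≤ p i
  deriv : ∀ i, ∀ t ∈ Icc 0 T, ∃ D : C(Torus d, ℝ),
    (∀ r, D r = scalarDrift (p i) (V i t r) (localField J θ a i (fun j => u j t) r) (u i t r)) ∧
    HasDerivWithinAt (u i) D (Icc 0 T) t

/-- Only the state that multiplies `relax` is truncated; the field need not be, since `relax` and
`force` are bounded uniformly in it. The invariant interval `[-p i, p i]` then makes the truncation
superfluous. -/
lemma exists_isContinuousSolution (hJ : Continuous J) (hp : ∀ i, p i ∈ Icc (0 : ℝ) 1)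
    {V : Fin 2 → ℝ → Torus d → ℝ} (hV : ∀ i, Continuous (Function.uncurry (V i))) {c : ℝ}
    (hc : ∀ i t r, |V i t r| ≤ c) (hT : 0 ≤ T) {m₀ : Torus d → ℝ} (hm₀ : Continuous m₀)
    (hm₀bd : ∀ r, |m₀ r| ≤ 1) :
    ∃ u, IsContinuousSolution J θ a p V T m₀ u := by
  obtain ⟨j, hj0, hj⟩ := exists_abs_le hJ
  let h : Fin 2 → (Fin 2 → C(Torus d, ℝ)) → Torus d → ℝ := fun i U r =>
    localField J θ a i (fun k => U k) r
  have hexp := (Real.exp_pos (2 * c)).le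
  obtain ⟨u, hu0, hu⟩ := exists_solution_of_bounded_lipschitz hT
    (fun i t U r => scalarDrift (p i) (V i t r) (h i U r) (clip (U i r)))
    -- In `K`, the `1` comes from the state; `4 * j` is the factor 2 of the drift estimate times `2
    -- * j` for the convolution of two colours.
    (L := 2 * Real.exp (2 * c)) (K := Real.exp (2 * c) * (1 + 4 * j))
    (fun i U => by
      have h1 : Continuous (h i U) :=
        (continuous_torusConv hJ (by fun_prop : Continuous fun r' => U 0 r' + U 1 r')).add
          continuous_const
      have h2 : Continuous fun q : ℝ × Torus d => (V i q.1 q.2, h i U q.2) :=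
        (hV i).prodMk (h1.comp continuous_snd)
      have h3 := continuous_relax.comp h2
      have h4 := continuous_force.comp h2
      simp only [Function.comp_def] at h3 h4
      unfold scalarDrift
      fun_prop)
    (by positivity) (by positivity)
    (fun i t U r => by
      have h1 := relax_le (hc i t r) (h i U r)
      have h2 := abs_force_le (hc i t r) (h i U r)
      have h3 := (relax_pos (V i t r) (h i U r)).le
      refine (abs_add_le _ _).trans ?_
      rw [abs_mul, abs_mul, abs_neg, abs_of_nonneg h3, abs_of_nonneg (hp i).1]
      have := mul_le_mul (abs_clip_le (U i r)) h1 h3 zero_le_one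
      have := mul_le_mul (hp i).2 h2 (abs_nonneg _) zero_le_one
      linarith)
    (fun i t U U' r => by
      have hd : ∀ k r, |U k r - U' k r| ≤ ‖U - U'‖ := fun k r =>
        (ContinuousMap.norm_coe_le_norm ((U - U') k) r).trans (norm_le_pi_norm _ k)
      have h1 := abs_localField_sub_le (θ := θ) (a := a) hJ hj
        (u := fun k => U k) (u' := fun k => U' k)
        (fun k => integrable_torus_of_continuous (U k).continuous)
        (fun k => integrable_torus_of_continuous (U' k).continuous)
        (fun k => ae_of_all _ (hd k)) i r
      refine (abs_scalarDrift_sub_le (hc i t r) (hp i) (abs_clip_le _) _ _ _).trans ?_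
      rw [mul_assoc]
      refine mul_le_mul_of_nonneg_left ?_ hexp
      have := (abs_clip_sub_le (U i r) (U' i r)).trans (hd i r)
      simp only [h]
      linarith)
    (fun i => ⟨fun r => p i * m₀ r, by fun_prop⟩)
  have hbound : ∀ i, ∀ t ∈ Icc 0 T, ∀ r, |u i t r| ≤ p i := by
    intro i t ht r
    refine abs_le_of_clipped_relaxation (f := fun t => u i t r)
      (A := fun t => relax (V i t r) (h i (fun k => u k t) r))
      (b := fun t => p i * force (V i t r) (h i (fun k => u k t) r)) (hp i)
      (fun s _ => relax_pos _ _) (fun s _ => ?_) ?_ (fun s hs => ?_) t ht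
    · rw [abs_mul, abs_of_nonneg (hp i).1]
      exact mul_le_mul_of_nonneg_left (abs_force_le_relax _ _) (hp i).1
    · rw [hu0]
      simp only [ContinuousMap.coe_mk, abs_mul, abs_of_nonneg (hp i).1]
      exact mul_le_of_le_one_right (hp i).1 (hm₀bd r)
    · obtain ⟨D, hD, hDer⟩ := hu i s hs
      exact (((ContinuousMap.evalCLM ℝ r).hasFDerivAt).comp_hasDerivWithinAt s hDer).congr_deriv
        (hD r)
  refine ⟨u, fun i r => by rw [hu0]; rfl, hbound, fun i t ht => ?_⟩
  obtain ⟨D, hD, hDer⟩ := hu i t ht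
  refine ⟨D, fun r => ?_, hDer⟩
  rw [hD, clip_of_abs_le ((hbound i t ht r).trans (hp i).2)]

/-- The class in `L^∞` of a continuous function. -/
noncomputable def toLinfty (f : C(Torus d, ℝ)) : Lp ℝ ∞ (volume : Measure (Torus d)) :=
  ContinuousMap.toLp ∞ volume ℝ f

lemma coeFn_toLinfty (f : C(Torus d, ℝ)) : toLinfty f =ᵐ[volume] f :=
  ContinuousMap.coeFn_toLp volume f

lemma localField_congr {u u' : Fin 2 → Torus d → ℝ} (h : ∀ i, u i =ᵐ[volume] u' i) (i : Fin 2) :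
    localField J θ a i u = localField J θ a i u' := by
  funext r
  simp only [localField, torusConv]
  congr 1
  refine integral_congr_ae ?_
  filter_upwards [h 0, h 1] with r' h0 h1
  rw [h0, h1]

lemma IsContinuousSolution.isSolution {V : Fin 2 → ℝ → Torus d → ℝ} {m₀ : Torus d → ℝ}
    {u : Fin 2 → ℝ → C(Torus d, ℝ)} (hu : IsContinuousSolution J θ a p V T m₀ u) :
    IsSolution J θ a p V T m₀ (fun i t => toLinfty (u i t)) := by
  refine ⟨fun i => ?_, fun i t ht => ?_⟩
  · filter_upwards [coeFn_toLinfty (u i 0)] with r hr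
    rw [hr, hu.init]
  · obtain ⟨D, hD, hDer⟩ := hu.deriv i t ht
    refine ⟨toLinfty D, ?_, ?_⟩
    · filter_upwards [coeFn_toLinfty D, coeFn_toLinfty (u i t)] with r h1 h2
      rw [h1, hD, drift_eq, h2, localField_congr fun k => coeFn_toLinfty (u k t)]
    · exact ((ContinuousMap.toLp ∞ volume ℝ :
        C(Torus d, ℝ) →L[ℝ] Lp ℝ ∞ (volume : Measure (Torus d))).hasFDerivAt).comp_hasDerivWithinAt
          t hDer

lemma ae_abs_le_norm (f : Lp ℝ ∞ (volume : Measure (Torus d))) : ∀ᵐ r, |f r| ≤ ‖f‖ := by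
  filter_upwards [ae_le_eLpNormEssSup (f := f) (μ := volume)] with r hr
  rw [← eLpNorm_exponent_top, ← Lp.enorm_def] at hr
  exact enorm_le_iff_norm_le.1 hr

lemma norm_le_of_ae_abs_le {f : Lp ℝ ∞ (volume : Measure (Torus d))} {c : ℝ} (hc : 0 ≤ c)
    (h : ∀ᵐ r, |f r| ≤ c) : ‖f‖ ≤ c := by
  simpa using Lp.norm_le_of_ae_bound (f := f) hc h

lemma integrable_of_Linfty (f : Lp ℝ ∞ (volume : Measure (Torus d))) : Integrable f :=
  (Lp.memLp f).integrable le_top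

/-- Uniqueness for the limiting equation in `L^∞`. -/
lemma IsContinuousSolution.eqOn (hJ : Continuous J) (hp : ∀ i, p i ∈ Icc (0 : ℝ) 1)
    {V : Fin 2 → ℝ → Torus d → ℝ} {c : ℝ} (hc : ∀ i, ∀ t ∈ Icc 0 T, ∀ r, |V i t r| ≤ c)
    {m₀ : Torus d → ℝ} {u : Fin 2 → ℝ → C(Torus d, ℝ)}
    (hu : IsContinuousSolution J θ a p V T m₀ u)
    {m : Fin 2 → ℝ → Lp ℝ ∞ (volume : Measure (Torus d))} (hm : IsSolution J θ a p V T m₀ m)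
    (i : Fin 2) : EqOn (m i) (fun t => toLinfty (u i t)) (Icc 0 T) := by
  obtain ⟨j, hj0, hj⟩ := exists_abs_le hJ
  have hs := hu.isSolution
  choose! D hD hDer using hm.2
  choose! E hE hEer using hs.2
  set f : ℝ → Fin 2 → Lp ℝ ∞ (volume : Measure (Torus d)) :=
    fun t k => m k t - toLinfty (u k t) with hf
  have hder : ∀ t ∈ Icc 0 T, HasDerivWithinAt f (fun k => D k t - E k t) (Icc 0 T) t :=
    fun t ht => hasDerivWithinAt_pi.2 fun k => (hDer k t ht).sub (hEer k t ht)
  -- Gronwall for the pair of colours at once, in the maximum of their two `L^∞` norms, since the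
  -- field couples them.
  have hzero := eq_zero_of_abs_deriv_le_mul_abs_self_of_eq_zero_right
    (K := Real.exp (2 * c) * (1 + 4 * j)) (fun t ht => (hder t ht).continuousWithinAt)
    (fun t ht => hasDerivWithinAt_Ici_of_Icc (hder t (Ico_subset_Icc_self ht)) ht)
    (by
      funext k
      rw [hf, Pi.zero_apply, sub_eq_zero]
      exact Lp.ext ((hm.1 k).trans (hs.1 k).symm))
    (fun t ht' => by
      have ht := Ico_subset_Icc_self ht'
      have hK : 0 ≤ Real.exp (2 * c) * (1 + 4 * j) * ‖f t‖ := by positivity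
      refine (pi_norm_le_iff_of_nonneg hK).2 fun k => norm_le_of_ae_abs_le hK ?_
      have hfk : ∀ l, ∀ᵐ r, |m l t r - toLinfty (u l t) r| ≤ ‖f t‖ := by
        intro l
        filter_upwards [ae_abs_le_norm (f t l), Lp.coeFn_sub (m l t) (toLinfty (u l t))]
          with r h1 h2
        rw [show m l t r - toLinfty (u l t) r = (f t l : Torus d → ℝ) r from h2.symm]
        exact h1.trans (norm_le_pi_norm _ l)
      have hfield := abs_localField_sub_le (θ := θ) (a := a) hJ hj
        (fun l => integrable_of_Linfty (m l t)) (fun l => integrable_of_Linfty (toLinfty (u l t)))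
        hfk k
      filter_upwards [hD k t ht, hE k t ht, Lp.coeFn_sub (D k t) (E k t), hfk k,
        coeFn_toLinfty (u k t)] with r h1 h2 h3 h4 h5
      rw [h3, Pi.sub_apply, h1, h2, drift_eq, drift_eq]
      refine (abs_scalarDrift_sub_le (hc k t ht r) (hp k) ?_ _ _ _).trans ?_
      · rw [h5]; exact (hu.bound k t ht r).trans (hp k).2
      · rw [mul_assoc]
        refine mul_le_mul_of_nonneg_left ?_ (Real.exp_pos _).le
        linarith [hfield r])
  intro t ht
  exact sub_eq_zero.1 (congrFun (hzero t ht) i)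

end LimitEquation

/-! ### Equi-Lipschitz functionals: from dense to all, from pointwise to uniform. -/

section Functionals

lemma tendsto_zero_of_dense {E : Type*} [NormedAddCommGroup E] {L : ℕ → E → ℝ} {C : ℝ}
    (hL : ∀ k x y, |L k x - L k y| ≤ C * ‖x - y‖) {s : Set E} (hs : Dense s)
    (h : ∀ x ∈ s, Tendsto (fun k => L k x) atTop (𝓝 0)) (x : E) :
    Tendsto (fun k => L k x) atTop (𝓝 0) := by
  rw [Metric.tendsto_atTop]
  intro ε hε
  obtain ⟨y, hy, hxy⟩ := Metric.dense_iff.1 hs x (ε / 2 / (|C| + 1)) (by positivity)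
  rw [Metric.mem_ball, dist_comm, dist_eq_norm, lt_div_iff₀ (by positivity)] at hy
  obtain ⟨N, hN⟩ := Metric.tendsto_atTop.1 (h y hxy) (ε / 2) (half_pos hε)
  refine ⟨N, fun k hk => ?_⟩
  have h1 := hN k hk
  have h2 := hL k x y
  have h3 : C * ‖x - y‖ ≤ ‖x - y‖ * (|C| + 1) := by
    nlinarith [norm_nonneg (x - y), le_abs_self C]
  rw [Real.dist_eq, sub_zero] at h1 ⊢
  have h4 := abs_add_le (L k x - L k y) (L k y)
  rw [sub_add_cancel] at h4
  linarith

/-- A finite net of the compact set suffices because the Lipschitz constant does not depend on `k`.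
The radius uses `|C| + 1`, so that `C` may be zero. -/
lemma eventually_forall_abs_le_of_isCompact {E : Type*} [NormedAddCommGroup E] {L : ℕ → E → ℝ}
    {C : ℝ} (hL : ∀ k x y, |L k x - L k y| ≤ C * ‖x - y‖)
    (h : ∀ x, Tendsto (fun k => L k x) atTop (𝓝 0)) {K : Set E} (hK : IsCompact K) {ε : ℝ}
    (hε : 0 < ε) : ∀ᶠ k in atTop, ∀ x ∈ K, |L k x| ≤ ε := by
  have hr : 0 < ε / 2 / (|C| + 1) := by positivity
  obtain ⟨t, -, htf, htK⟩ := hK.finite_cover_balls hr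
  have hev : ∀ᶠ k in atTop, ∀ y ∈ t, |L k y| < ε / 2 := by
    refine (eventually_all_finite htf).2 fun y _ => ?_
    have := (h y).abs
    rw [abs_zero] at this
    exact this.eventually_lt_const (half_pos hε)
  filter_upwards [hev] with k hk x hx
  obtain ⟨y, hy, hxy⟩ := mem_iUnion₂.1 (htK hx)
  rw [Metric.mem_ball, dist_eq_norm, lt_div_iff₀ (by positivity)] at hxy
  have h2 := hL k x y
  have h3 : C * ‖x - y‖ ≤ ‖x - y‖ * (|C| + 1) := by
    nlinarith [norm_nonneg (x - y), le_abs_self C]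
  have h4 := abs_add_le (L k x - L k y) (L k y)
  rw [sub_add_cancel] at h4
  linarith [hk y hy]

end Functionals

/-! ### Laws of large numbers for the disorder. -/

section RandomField

variable {d : ℕ} {a p : Fin 2 → ℝ} {Ω : Type*} [MeasurableSpace Ω] {P : Measure Ω}
  {α : (Fin d → ℤ) → Ω → ℝ}

lemma colour_mem {n : ℕ} (a : Fin 2 → ℝ) (α : (Fin d → ℤ) → ℝ) (i : Fin 2) (x : Site d n) :
    colour a α i x ∈ Icc (0 : ℝ) 1 := by
  unfold colour; split_ifs <;> simp

lemma abs_colour_le {n : ℕ} (a : Fin 2 → ℝ) (α : (Fin d → ℤ) → ℝ) (i : Fin 2) (x : Site d n) :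
    |colour a α i x| ≤ 1 := by
  rw [abs_of_nonneg (colour_mem a α i x).1]; exact (colour_mem a α i x).2

lemma prob_mem [IsProbabilityMeasure P] (hαlaw : ∀ x i, P.real {ω | α x ω = a i} = p i)
    (i : Fin 2) : p i ∈ Icc (0 : ℝ) 1 := by
  rw [← hαlaw 0 i]; exact ⟨measureReal_nonneg, measureReal_le_one⟩

/-- The weights change with `k`, so a quantitative bound is used: by Hoeffding the opposite event
has probability at most `exp (-ε² N / 2)` with `N = n ^ d` sites, which is summable, and
Borel–Cantelli applies. -/
lemma eventually_siteAvg_colour_sub_lt (hd : 0 < d) [IsProbabilityMeasure P]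
    (hαmeas : ∀ x, Measurable (α x)) (hαindep : iIndepFun α P)
    (hαlaw : ∀ x i, P.real {ω | α x ω = a i} = p i) (i : Fin 2)
    {w : ∀ k : ℕ, Site d (2 * k + 1) → ℝ} (hw : ∀ k x, |w k x| ≤ 1) {ε : ℝ} (hε : 0 < ε) :
    ∀ᵐ ω ∂P, ∀ᶠ k in atTop,
      siteAvg (fun x => (colour a (fun z => α z ω) i x - p i) * w k x) < ε := by
  classical
  have hp := prob_mem hαlaw i
  have key : ∀ k : ℕ, P.real {ω | ε ≤ siteAvg (fun x : Site d (2 * k + 1) =>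
      (colour a (fun z => α z ω) i x - p i) * w k x)} ≤ Real.exp (-(ε ^ 2 / 2)) ^ k := by
    intro k
    set N : ℝ := (Fintype.card (Site d (2 * k + 1)) : ℝ) with hN
    -- Since `d ≥ 1`, the crude bound `N ≥ k` already yields a geometric series.
    have hNk : (k : ℝ) ≤ N := by
      have h1 : k ≤ (2 * k + 1) ^ d :=
        (by omega : k ≤ 2 * k + 1).trans (Nat.le_self_pow hd.ne' _)
      rw [hN]
      simpa [ZMod.card] using (Nat.cast_le (α := ℝ)).2 h1
    have hN0 : 0 < N := Nat.cast_pos.2 Fintype.card_pos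
    let rep : Site d (2 * k + 1) → (Fin d → ℤ) := fun x j => (x j).valMinAbs
    have hrep : Function.Injective rep := fun x y hxy =>
      funext fun j => ZMod.injective_valMinAbs (congrFun hxy j)
    let g : Site d (2 * k + 1) → ℝ → ℝ := fun x y => ((if y = a i then 1 else 0) - p i) * w k x
    have hg : ∀ x, Measurable (g x) := fun x =>
      ((Measurable.ite (measurableSet_singleton (a i)) measurable_const
        measurable_const).sub_const _).mul_const _
    have hind : iIndepFun (fun x => g x ∘ α (rep x)) P := (hαindep.precomp hrep).comp g hg
    have hgX : ∀ x ω, (g x ∘ α (rep x)) ω = (colour a (fun z => α z ω) i x - p i) * w k x := by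
      intro x ω
      simp only [g, rep, Function.comp_apply, colour, field]
      congr!
    have hmeas : ∀ x, Measurable (g x ∘ α (rep x)) := fun x => (hg x).comp (hαmeas _)
    have hmean : ∀ x, P[g x ∘ α (rep x)] = 0 := by
      intro x
      have e : (g x ∘ α (rep x)) =
          fun ω => ({ω | α (rep x) ω = a i}.indicator (fun _ => (1 : ℝ)) ω - p i) * w k x := by
        funext ω
        simp [g, Set.indicator_apply]
      have hms : MeasurableSet {ω | α (rep x) ω = a i} :=
        hαmeas _ (measurableSet_singleton (a i))
      rw [e, integral_mul_const, integral_sub ((integrable_const _).indicator hms)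
        (integrable_const _), integral_indicator_const _ hms, hαlaw]
      simp
    have hsub : ∀ x ∈ Finset.univ, HasSubgaussianMGF (g x ∘ α (rep x)) 1 P := by
      intro x _
      have := hasSubgaussianMGF_of_mem_Icc_of_integral_eq_zero (a := -1) (b := 1)
        (hmeas x).aemeasurable (ae_of_all P fun ω => by
          rw [hgX, mem_Icc, ← abs_le, abs_mul]
          refine mul_le_one₀ (abs_le.2 ?_) (abs_nonneg _) (hw k x)
          have := colour_mem a (fun z => α z ω) i x
          exact ⟨by linarith [this.1, hp.2], by linarith [this.2, hp.1]⟩) (hmean x)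
      -- Variables in `[-1, 1]` have variance proxy `((1 - (-1)) / 2) ^ 2 = 1`.
      convert this using 1
      ext
      norm_num
    have hoeff := HasSubgaussianMGF.measure_sum_ge_le_of_iIndepFun hind hsub
      (mul_nonneg hε.le hN0.le)
    have hset : {ω | ε ≤ siteAvg (fun x : Site d (2 * k + 1) =>
        (colour a (fun z => α z ω) i x - p i) * w k x)} =
        {ω | ε * N ≤ ∑ x, (g x ∘ α (rep x)) ω} := by
      ext ω
      simp only [mem_ofPred_eq, siteAvg, card_site_inv, hgX]
      rw [← hN, inv_mul_eq_div, le_div_iff₀ hN0]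
    rw [hset]
    refine hoeff.trans ?_
    rw [← Real.exp_nat_mul, Real.exp_le_exp]
    simp only [Finset.sum_const, Finset.card_univ, nsmul_eq_mul, mul_one, NNReal.coe_natCast]
    rw [← hN]
    have e : -(ε * N) ^ 2 / (2 * N) = -(ε ^ 2 / 2) * N := by field_simp
    rw [e]
    nlinarith [sq_nonneg ε, mul_le_mul_of_nonneg_left hNk (by positivity : 0 ≤ ε ^ 2 / 2)]
  have hsum : ∑' k : ℕ, P {ω | ε ≤ siteAvg (fun x : Site d (2 * k + 1) =>
      (colour a (fun z => α z ω) i x - p i) * w k x)} ≠ ∞ := by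
    have hq : Real.exp (-(ε ^ 2 / 2)) < 1 := by
      rw [← Real.exp_zero, Real.exp_lt_exp]
      have := pow_pos hε 2
      linarith
    have hs := summable_geometric_of_lt_one (Real.exp_pos _).le hq
    refine ne_top_of_le_ne_top hs.tsum_ofReal_ne_top (ENNReal.tsum_le_tsum fun k => ?_)
    rw [← ofReal_measureReal]
    exact ENNReal.ofReal_le_ofReal (key k)
  filter_upwards [ae_eventually_notMem hsum] with ω hω
  filter_upwards [hω] with k hk
  exact not_le.1 hk

/-- The one-sided bound is applied to `w` and `-w`, rescaled by `C + 1`, along the countably many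
levels `1 / (m + 1)`. -/
lemma tendsto_siteAvg_colour_sub (hd : 0 < d) [IsProbabilityMeasure P]
    (hαmeas : ∀ x, Measurable (α x)) (hαindep : iIndepFun α P)
    (hαlaw : ∀ x i, P.real {ω | α x ω = a i} = p i) (i : Fin 2)
    {w : ∀ k : ℕ, Site d (2 * k + 1) → ℝ} {C : ℝ} (hw : ∀ k x, |w k x| ≤ C) :
    ∀ᵐ ω ∂P, Tendsto (fun k => siteAvg (fun x => (colour a (fun z => α z ω) i x - p i) * w k x))
      atTop (𝓝 0) := by
  have hC : 0 ≤ C := (abs_nonneg _).trans (hw 0 0)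
  have hC' : 0 < C + 1 := by linarith
  have hw1 : ∀ k x, |w k x / (C + 1)| ≤ 1 := fun k x => by
    rw [abs_div, abs_of_pos hC', div_le_one hC']; linarith [hw k x]
  have hw2 : ∀ k x, |-(w k x / (C + 1))| ≤ 1 := fun k x => by rw [abs_neg]; exact hw1 k x
  have h1 := fun m : ℕ => eventually_siteAvg_colour_sub_lt hd hαmeas hαindep hαlaw i hw1
    (ε := 1 / ((m : ℝ) + 1)) (by positivity)
  have h2 := fun m : ℕ => eventually_siteAvg_colour_sub_lt hd hαmeas hαindep hαlaw i hw2
    (ε := 1 / ((m : ℝ) + 1)) (by positivity)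
  filter_upwards [ae_all_iff.2 h1, ae_all_iff.2 h2] with ω hω1 hω2
  have hlim : Tendsto (fun k => siteAvg (fun x =>
      (colour a (fun z => α z ω) i x - p i) * (w k x / (C + 1)))) atTop (𝓝 0) := by
    rw [Metric.tendsto_atTop']
    intro ε hε
    obtain ⟨m, hm⟩ := exists_nat_one_div_lt hε
    obtain ⟨N, hN⟩ := eventually_atTop.1 ((hω1 m).and (hω2 m))
    refine ⟨N, fun k hk => ?_⟩
    obtain ⟨h3, h4⟩ := hN k hk.le
    have e : siteAvg (fun x => (colour a (fun z => α z ω) i x - p i) * -(w k x / (C + 1))) =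
        -siteAvg (fun x => (colour a (fun z => α z ω) i x - p i) * (w k x / (C + 1))) := by
      rw [← neg_one_mul, ← siteAvg_mul_left]
      congr 1; funext x; ring
    rw [e] at h4
    rw [Real.dist_eq, sub_zero, abs_lt]
    constructor <;> linarith
  have := hlim.const_mul (C + 1)
  rw [mul_zero] at this
  refine this.congr fun k => ?_
  rw [← siteAvg_mul_left]
  congr 1; funext x; field_simp

/-- The coloured lattice averages against `s` of a continuous function, minus their limit. -/
noncomputable def colouredError (a p : Fin 2 → ℝ) (α : (Fin d → ℤ) → ℝ) (i : Fin 2)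
    (s : ∀ k : ℕ, Site d (2 * k + 1) → ℝ) (g : Torus d → ℝ) (k : ℕ) (φ : C(Torus d, ℝ)) : ℝ :=
  siteAvg (fun x => colour a α i x * s k x * φ (scalePt x)) - p i * ∫ r, φ r * g r

lemma abs_integral_torus_le {f : Torus d → ℝ} {c : ℝ} (h : ∀ r, |f r| ≤ c) : |∫ r, f r| ≤ c := by
  simpa using norm_integral_le_of_norm_le_const (μ := (volume : Measure (Torus d))) (f := f)
    (ae_of_all _ h)

/-- This equi-Lipschitz bound carries convergence from a dense sequence of test functions to all of
them, and makes it uniform on compact sets. -/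
lemma abs_colouredError_sub_le {α : (Fin d → ℤ) → ℝ} {i : Fin 2} (hp : p i ∈ Icc (0 : ℝ) 1)
    {s : ∀ k : ℕ, Site d (2 * k + 1) → ℝ} (hs : ∀ k x, |s k x| ≤ 1) {g : Torus d → ℝ}
    (hg : Continuous g) (hg1 : ∀ r, |g r| ≤ 1) (k : ℕ) (φ ψ : C(Torus d, ℝ)) :
    |colouredError a p α i s g k φ - colouredError a p α i s g k ψ| ≤ 2 * ‖φ - ψ‖ := by
  have hd : ∀ r, |φ r - ψ r| ≤ ‖φ - ψ‖ := fun r => ContinuousMap.norm_coe_le_norm (φ - ψ) r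
  have e : colouredError a p α i s g k φ - colouredError a p α i s g k ψ =
      siteAvg (fun x => colour a α i x * s k x * (φ (scalePt x) - ψ (scalePt x)))
        - p i * ∫ r, (φ r - ψ r) * g r := by
    have h1 : ∫ r, (φ r - ψ r) * g r = (∫ r, φ r * g r) - ∫ r, ψ r * g r := by
      rw [← integral_sub (integrable_torus_of_continuous (by fun_prop))
        (integrable_torus_of_continuous (by fun_prop))]
      simp only [sub_mul]
    simp only [colouredError, mul_sub, siteAvg_sub, h1]
    ring
  have h1 : |siteAvg (fun x => colour a α i x * s k x * (φ (scalePt x) - ψ (scalePt x)))|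
      ≤ ‖φ - ψ‖ := by
    refine abs_siteAvg_le_of_le fun x => ?_
    rw [abs_mul, abs_mul]
    refine (mul_le_of_le_one_left (abs_nonneg _) ?_).trans (hd _)
    exact mul_le_one₀ (abs_colour_le a α i x) (abs_nonneg _) (hs k x)
  have h2 : |p i * ∫ r, (φ r - ψ r) * g r| ≤ ‖φ - ψ‖ := by
    rw [abs_mul, abs_of_nonneg hp.1]
    refine (mul_le_of_le_one_left (abs_nonneg _) hp.2).trans (abs_integral_torus_le fun r => ?_)
    rw [abs_mul]
    exact (mul_le_of_le_one_right (abs_nonneg _) (hg1 r)).trans (hd r)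
  rw [e]
  refine (abs_sub _ _).trans ?_
  linarith

/-- Almost surely, the coloured averages of all continuous functions converge. -/
lemma ae_forall_tendsto_colouredError (hd : 0 < d) [IsProbabilityMeasure P]
    (hαmeas : ∀ x, Measurable (α x)) (hαindep : iIndepFun α P)
    (hαlaw : ∀ x i, P.real {ω | α x ω = a i} = p i) (i : Fin 2)
    {s : ∀ k : ℕ, Site d (2 * k + 1) → ℝ} (hs : ∀ k x, |s k x| ≤ 1) {g : Torus d → ℝ}
    (hg : Continuous g) (hg1 : ∀ r, |g r| ≤ 1)
    (hsg : ∀ φ : Torus d → ℝ, Continuous φ →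
      Tendsto (fun k => siteAvg (fun x => s k x * φ (scalePt x))) atTop (𝓝 (∫ r, φ r * g r))) :
    ∀ᵐ ω ∂P, ∀ φ : C(Torus d, ℝ),
      Tendsto (fun k => colouredError a p (fun z => α z ω) i s g k φ) atTop (𝓝 0) := by
  have h : ∀ φ : C(Torus d, ℝ), ∀ᵐ ω ∂P,
      Tendsto (fun k => colouredError a p (fun z => α z ω) i s g k φ) atTop (𝓝 0) := by
    intro φ
    have hw : ∀ (k : ℕ) (x : Site d (2 * k + 1)), |s k x * φ (scalePt x)| ≤ ‖φ‖ := fun k x => by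
      rw [abs_mul]
      exact (mul_le_of_le_one_left (abs_nonneg _) (hs k x)).trans
        (ContinuousMap.norm_coe_le_norm φ _)
    filter_upwards [tendsto_siteAvg_colour_sub hd hαmeas hαindep hαlaw i hw] with ω hω
    -- Once the colour is replaced by its mean `p i`, the averages left over are nonrandom and
    -- converge by `hsg`.
    have h2 := ((hsg φ φ.continuous).sub_const (∫ r, φ r * g r)).const_mul (p i)
    rw [sub_self, mul_zero] at h2
    have h3 := hω.add h2
    rw [add_zero] at h3
    refine h3.congr fun k => ?_
    rw [colouredError, mul_sub, ← siteAvg_mul_left, ← add_sub_assoc, ← siteAvg_add]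
    congr 2; funext x; ring
  -- A countable dense family reduces the exceptional sets to a single null set.
  have hden := TopologicalSpace.denseRange_denseSeq C(Torus d, ℝ)
  filter_upwards [ae_all_iff.2 fun m => h (TopologicalSpace.denseSeq _ m)] with ω hω
  exact tendsto_zero_of_dense (abs_colouredError_sub_le (prob_mem hαlaw i) hs hg hg1) hden
    (by rintro _ ⟨m, rfl⟩; exact hω m)

/-- The two events are disjoint because `a 0 ≠ a 1`, their probabilities sum to one, and there are
countably many sites. -/
lemma ae_mem_colours [IsProbabilityMeasure P] (hαmeas : ∀ x, Measurable (α x))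
    (ha : a 0 ≠ a 1) (hp : p 0 + p 1 = 1) (hαlaw : ∀ x i, P.real {ω | α x ω = a i} = p i) :
    ∀ᵐ ω ∂P, ∀ z, ∃ i, α z ω = a i := by
  refine ae_all_iff.2 fun z => ?_
  have hms : ∀ i, MeasurableSet {ω | α z ω = a i} := fun i =>
    hαmeas z (measurableSet_singleton (a i))
  have hdisj : Disjoint {ω | α z ω = a 0} {ω | α z ω = a 1} :=
    Set.disjoint_left.2 fun ω h0 h1 => ha (h0.symm.trans h1)
  have hu : P.real ({ω | α z ω = a 0} ∪ {ω | α z ω = a 1}) = 1 := by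
    rw [measureReal_union hdisj (hms 1), hαlaw, hαlaw, hp]
  have h1 : P ({ω | α z ω = a 0} ∪ {ω | α z ω = a 1}) = 1 := by
    rw [← ofReal_measureReal, hu, ENNReal.ofReal_one]
  have h2 := (prob_compl_eq_zero_iff ((hms 0).union (hms 1))).2 h1
  filter_upwards [mem_ae_iff.2 h2] with ω hω
  rcases hω with h | h
  exacts [⟨0, h⟩, ⟨1, h⟩]

end RandomField

instance : MeasurableSingletonClass ℤˣ :=
  ⟨fun u => ⟨{(u : ℤ)}, measurableSet_singleton _, by ext v; simp [Units.ext_iff]⟩⟩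

/-! ### One-dimensional marginals on path space. -/

section Paths

variable {d n : ℕ} {T : ℝ}

/-- The probability that the path is in the configuration `η` at time `s`. -/
noncomputable def marginal (hT : 0 ≤ T) (Q : Measure (PathSpace d n T)) (s : ℝ)
    (η : Config d n) : ℝ :=
  Q.real {w | w.1 (projIcc 0 T hT s) = η}

lemma marginal_nonneg (hT : 0 ≤ T) (Q : Measure (PathSpace d n T)) (s : ℝ) (η : Config d n) :
    0 ≤ marginal hT Q s η := measureReal_nonneg

lemma measurable_eval (t : Icc (0 : ℝ) T) : Measurable fun w : PathSpace d n T => w.1 t :=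
  (measurable_pi_apply t).comp measurable_subtype_coe

variable [NeZero n]

lemma measurableSet_path_eq (t : Icc (0 : ℝ) T) (η : Config d n) :
    MeasurableSet {w : PathSpace d n T | w.1 t = η} :=
  measurable_eval t (measurableSet_singleton η)

/-- Right continuous paths are jointly measurable in time and path. -/
lemma measurable_path_uncurry (hT : 0 ≤ T) (f : Config d n → ℝ) :
    Measurable fun q : ℝ × PathSpace d n T => f (q.2.1 (projIcc 0 T hT q.1)) := by
  have hf : Measurable f := measurable_of_finite f
  -- `τ m s` is the next grid point strictly to the right of `s`: it takes countably many values,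
  -- and right continuity gives convergence along it.
  let τ : ℕ → ℝ → ℝ := fun m s => (⌊((m : ℝ) + 1) * s⌋ + 1) / ((m : ℝ) + 1)
  refine measurable_of_tendsto_metrizable
    (f := fun (m : ℕ) (q : ℝ × PathSpace d n T) => f (q.2.1 (projIcc 0 T hT (τ m q.1)))) ?_ ?_
  · intro m
    have h1 : Measurable fun q : ℤ × PathSpace d n T =>
        f (q.2.1 (projIcc 0 T hT ((q.1 + 1) / ((m : ℝ) + 1)))) :=
      measurable_from_prod_countable_right fun z =>
        hf.comp (measurable_eval (projIcc 0 T hT ((z + 1) / ((m : ℝ) + 1))))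
    exact h1.comp ((Int.measurable_floor.comp (measurable_fst.const_mul _)).prodMk measurable_snd)
  · rw [tendsto_pi_nhds]
    rintro ⟨s, w⟩
    have hτ : ∀ m, s < τ m s ∧ τ m s ≤ s + 1 / ((m : ℝ) + 1) := by
      intro m
      have hm : (0 : ℝ) < (m : ℝ) + 1 := by positivity
      constructor
      · rw [lt_div_iff₀ hm, mul_comm]
        exact Int.lt_floor_add_one _
      · have h1 : (s + 1 / ((m : ℝ) + 1)) * ((m : ℝ) + 1) = ((m : ℝ) + 1) * s + 1 := by field_simp
        rw [div_le_iff₀ hm, h1]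
        linarith [Int.floor_le (((m : ℝ) + 1) * s)]
    have hlim : Tendsto (fun m => τ m s) atTop (𝓝 s) := by
      refine tendsto_of_tendsto_of_tendsto_of_le_of_le tendsto_const_nhds ?_
        (fun m => (hτ m).1.le) (fun m => (hτ m).2)
      simpa using tendsto_one_div_add_atTop_nhds_zero_nat.const_add s
    have hlim' : Tendsto (fun m => projIcc 0 T hT (τ m s)) atTop (𝓝[≥] projIcc 0 T hT s) :=
      tendsto_nhdsWithin_iff.2 ⟨(continuous_projIcc.tendsto s).comp hlim,
        Eventually.of_forall fun m => monotone_projIcc hT (hτ m).1.le⟩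
    -- Outside `[0, T]` the projection is constant, so the approximating times may equal their
    -- limit; hence a closed right neighbourhood.
    have hw : ∀ᶠ t in 𝓝[≥] projIcc 0 T hT s, w.1 t = w.1 (projIcc 0 T hT s) := by
      rw [← Ioi_insert, nhdsWithin_insert, eventually_sup]
      exact ⟨rfl, (w.2 _).1⟩
    exact tendsto_const_nhds.congr' ((hlim'.eventually hw).mono fun m hm => by
      simp only [hm])

lemma integral_path_eq_sum (hT : 0 ≤ T) (Q : Measure (PathSpace d n T)) [IsProbabilityMeasure Q]
    (s : ℝ) (f : Config d n → ℝ) :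
    ∫ w, f (w.1 (projIcc 0 T hT s)) ∂Q = ∑ η, marginal hT Q s η * f η := by
  classical
  have e : (fun w : PathSpace d n T => f (w.1 (projIcc 0 T hT s))) = fun w =>
      ∑ η, {w : PathSpace d n T | w.1 (projIcc 0 T hT s) = η}.indicator (fun _ => f η) w := by
    funext w
    simp [Set.indicator_apply]
  rw [e, integral_finsetSum _ fun η _ =>
    (integrable_const _).indicator (measurableSet_path_eq _ η)]
  refine Finset.sum_congr rfl fun η _ => ?_
  rw [integral_indicator_const _ (measurableSet_path_eq _ η), smul_eq_mul, marginal]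

lemma sum_marginal (hT : 0 ≤ T) (Q : Measure (PathSpace d n T)) [IsProbabilityMeasure Q] (s : ℝ) :
    ∑ η, marginal hT Q s η = 1 := by
  have := integral_path_eq_sum hT Q s (fun _ => 1)
  simpa using this.symm

/-- This is the Fubini hypothesis for exchanging the time integral in the martingale problem with
the expectation. -/
lemma integrable_path_uncurry (hT : 0 ≤ T) (Q : Measure (PathSpace d n T)) [IsProbabilityMeasure Q]
    {g : ℝ → Config d n → ℝ} (hg : ∀ η, Continuous fun s => g s η) (b c : ℝ) :
    Integrable (Function.uncurry fun (s : ℝ) (w : PathSpace d n T) =>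
      g s (w.1 (projIcc 0 T hT s))) ((volume.restrict (uIoc b c)).prod Q) := by
  classical
  have e : (Function.uncurry fun (s : ℝ) (w : PathSpace d n T) => g s (w.1 (projIcc 0 T hT s))) =
      fun q => ∑ η, (if q.2.1 (projIcc 0 T hT q.1) = η then 1 else 0) * g q.1 η := by
    funext q
    simp [Function.uncurry_def]
  rw [e]
  refine integrable_finsetSum _ fun η _ => ?_
  obtain ⟨C, hC⟩ := (isCompact_uIcc (a := b) (b := c)).exists_bound_of_continuousOn
    (hg η).continuousOn
  have hfin : IsFiniteMeasure (volume.restrict (uIoc b c)) :=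
    ⟨by rw [Measure.restrict_apply_univ, uIoc]; exact measure_Ioc_lt_top⟩
  refine Integrable.of_bound (C := C) ?_ ?_
  · exact (((measurable_path_uncurry hT fun ζ => if ζ = η then (1 : ℝ) else 0)).mul
      ((hg η).measurable.comp measurable_fst)).aestronglyMeasurable
  · have h1 : ∀ᵐ s ∂(volume.restrict (uIoc b c)), s ∈ uIoc b c :=
      ae_restrict_mem measurableSet_uIoc
    have h2 : ∀ᵐ q ∂((volume.restrict (uIoc b c)).prod Q), q.1 ∈ uIoc b c :=
      Measure.quasiMeasurePreserving_fst.ae h1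
    filter_upwards [h2] with q hq
    rw [norm_mul]
    refine (mul_le_of_le_one_left (norm_nonneg _) ?_).trans (hC _ (uIoc_subset_uIcc hq))
    split_ifs <;> simp

end Paths

/-! ### From the martingale problem to the forward equation. -/

section ForwardEquation

variable {d n : ℕ} [NeZero n] {T : ℝ} {J : Torus d → ℝ} {θ : ℝ} {a : Fin 2 → ℝ}
  {V : Fin 2 → ℝ → Torus d → ℝ} {α : (Fin d → ℤ) → ℝ} {σ₀ : Config d n}
  {Q : Measure (PathSpace d n T)}

lemma generator_congr {V W : Fin 2 → ℝ → Torus d → ℝ} {s : ℝ} (h : ∀ i r, V i s r = W i s r)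
    (f : Config d n → ℝ) (η : Config d n) :
    generator J θ a V α s f η = generator J θ a W α s f η := by
  simp only [generator, perturbedRate, potential, h]

/-- This permits replacing the potential by an extension that is continuous at all real times. -/
lemma IsGlauberLaw.congr {hT : 0 ≤ T} (hQ : IsGlauberLaw J θ a V α hT σ₀ Q)
    {W : Fin 2 → ℝ → Torus d → ℝ} (h : ∀ i, ∀ s ∈ Icc 0 T, ∀ r, V i s r = W i s r) :
    IsGlauberLaw J θ a W α hT σ₀ Q := by
  refine ⟨hQ.1, hQ.2.1, fun f => ?_⟩
  have e : ∀ (t : Icc (0 : ℝ) T) (w : PathSpace d n T),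
      ∫ s in (0 : ℝ)..t, generator J θ a W α s f (w.1 (projIcc 0 T hT s)) =
        ∫ s in (0 : ℝ)..t, generator J θ a V α s f (w.1 (projIcc 0 T hT s)) := by
    intro t w
    refine intervalIntegral.integral_congr fun s hs => ?_
    rw [uIcc_of_le t.2.1] at hs
    exact (generator_congr (fun i r => h i s ⟨hs.1, hs.2.trans t.2.2⟩ r) _ _).symm
  simpa only [e] using hQ.2.2 f

lemma continuous_perturbedRate (hV : ∀ i r, Continuous fun s => V i s r) (x : Site d n)
    (η : Config d n) : Continuous fun s => perturbedRate J θ a V α x η s := by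
  unfold perturbedRate potential
  fun_prop

lemma continuous_generator (hV : ∀ i r, Continuous fun s => V i s r) (f : Config d n → ℝ)
    (η : Config d n) : Continuous fun s => generator J θ a V α s f η := by
  have := fun x => continuous_perturbedRate (J := J) (θ := θ) (a := a) (α := α) hV x η
  unfold generator
  fun_prop

lemma IsGlauberLaw.marginal_zero {hT : 0 ≤ T} (hQ : IsGlauberLaw J θ a V α hT σ₀ Q)
    (f : Config d n → ℝ) : ∑ η, marginal hT Q 0 η * f η = f σ₀ := by
  have := hQ.1
  rw [← integral_path_eq_sum]
  have h : ∀ᵐ w ∂Q, f (w.1 (projIcc 0 T hT 0)) = f σ₀ := by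
    filter_upwards [hQ.2.1] with w hw
    rw [projIcc_left, hw]
  rw [integral_congr_ae h]
  simp

/-- The integrated forward equation for the one-dimensional marginals. -/
lemma IsGlauberLaw.sum_marginal_eq {hT : 0 ≤ T} (hQ : IsGlauberLaw J θ a V α hT σ₀ Q)
    (hV : ∀ i r, Continuous fun s => V i s r) (f : Config d n → ℝ) {t : ℝ} (ht : t ∈ Icc 0 T) :
    ∑ η, marginal hT Q t η * f η =
      f σ₀ + ∫ s in (0 : ℝ)..t, ∑ η, marginal hT Q s η * generator J θ a V α s f η := by
  have := hQ.1
  have hint := fun b c => integrable_path_uncurry hT Q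
    (continuous_generator (J := J) (θ := θ) (a := a) (α := α) hV f) b c
  have hmart := (hQ.2.2 f).setIntegral_eq (i := ⟨0, left_mem_Icc.2 hT⟩) (j := ⟨t, ht⟩) ht.1
    MeasurableSet.univ
  simp only [Measure.restrict_univ, intervalIntegral.integral_same, sub_self,
    integral_zero] at hmart
  have hb : ∀ s, Integrable (fun w : PathSpace d n T => f (w.1 s)) Q := by
    intro s
    obtain ⟨C, hC⟩ := (Set.finite_range f).isBounded.exists_norm_le
    exact Integrable.of_bound ((measurable_of_finite f).comp
      (measurable_eval s)).aestronglyMeasurable C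
      (ae_of_all _ fun w => hC _ (mem_range_self _))
  have hI : Integrable (fun w : PathSpace d n T =>
      ∫ s in (0 : ℝ)..t, generator J θ a V α s f (w.1 (projIcc 0 T hT s))) Q := by
    simp only [intervalIntegral.integral_of_le ht.1]
    have := (hint 0 t).integral_prod_right
    rwa [uIoc_of_le ht.1] at this
  have hb2 : Integrable (fun w : PathSpace d n T =>
      f (w.1 ⟨t, ht⟩) - f (w.1 ⟨0, left_mem_Icc.2 hT⟩)) Q := (hb _).sub (hb _)
  rw [integral_sub hb2 hI, integral_sub (hb _) (hb _),
    ← intervalIntegral_integral_swap (hint 0 t)] at hmart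
  simp only [integral_path_eq_sum] at hmart
  have e1 := integral_path_eq_sum hT Q t f
  have e2 := integral_path_eq_sum hT Q 0 f
  rw [projIcc_of_mem hT ht] at e1
  rw [projIcc_left, hQ.marginal_zero] at e2
  rw [e1, e2] at hmart
  linarith

/-- A bootstrap: the integrated equation exhibits the marginal as a primitive, hence as continuous;
the integrand is then continuous too, and the equation can be differentiated. -/
lemma IsGlauberLaw.continuous_marginal {hT : 0 ≤ T} (hQ : IsGlauberLaw J θ a V α hT σ₀ Q)
    (hV : ∀ i r, Continuous fun s => V i s r) (η : Config d n) :
    Continuous fun s => marginal hT Q s η := by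
  classical
  have := hQ.1
  let f : Config d n → ℝ := fun ζ => if ζ = η then 1 else 0
  have hprim : Continuous fun t =>
      ∫ s in (0 : ℝ)..t, ∑ ζ, marginal hT Q s ζ * generator J θ a V α s f ζ := by
    refine intervalIntegral.continuous_primitive (fun b c => ?_) 0
    rw [intervalIntegrable_iff, IntegrableOn]
    have := (integrable_path_uncurry hT Q
      (continuous_generator (J := J) (θ := θ) (a := a) (α := α) hV f) b c).integral_prod_left
    simpa only [Function.uncurry_apply_pair, integral_path_eq_sum] using this
  have e : (fun s => marginal hT Q s η) = fun s => f σ₀ +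
      ∫ s in (0 : ℝ)..(projIcc 0 T hT s : ℝ),
        ∑ ζ, marginal hT Q s ζ * generator J θ a V α s f ζ := by
    funext s
    rw [← hQ.sum_marginal_eq hV f (projIcc 0 T hT s).2]
    simp [f, marginal]
  rw [e]
  exact (hprim.comp (continuous_subtype_val.comp continuous_projIcc)).const_add _

/-- The forward equation for observables that depend on time. -/
lemma IsGlauberLaw.hasDerivWithinAt_sum {hT : 0 ≤ T} (hQ : IsGlauberLaw J θ a V α hT σ₀ Q)
    (hV : ∀ i r, Continuous fun s => V i s r) {F F' : ℝ → Config d n → ℝ} {t : ℝ}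
    (ht : t ∈ Icc 0 T) (hF : ∀ η, HasDerivWithinAt (fun s => F s η) (F' t η) (Icc 0 T) t) :
    HasDerivWithinAt (fun s => ∑ η, marginal hT Q s η * F s η)
      (∑ η, marginal hT Q t η * (generator J θ a V α t (F t) η + F' t η)) (Icc 0 T) t := by
  classical
  let f : Config d n → Config d n → ℝ := fun η ζ => if ζ = η then 1 else 0
  have hder : ∀ η, HasDerivWithinAt (fun s => marginal hT Q s η)
      (∑ ζ, marginal hT Q t ζ * generator J θ a V α t (f η) ζ) (Icc 0 T) t := by
    intro η
    have hc : Continuous fun s => ∑ ζ, marginal hT Q s ζ * generator J θ a V α s (f η) ζ := by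
      have h1 := hQ.continuous_marginal hV
      have h2 := continuous_generator (J := J) (θ := θ) (a := a) (α := α) hV (f η)
      fun_prop
    refine (((hc.integral_hasStrictDerivAt 0 t).hasDerivAt.const_add
      (f η σ₀)).hasDerivWithinAt).congr_of_mem (fun s hs => ?_) ht
    rw [← hQ.sum_marginal_eq hV (f η) hs]
    simp [f]
  -- Product rule over the finite state space. The remaining sums are rearranged by duality: the
  -- generator applied to the indicators `f η`, weighted by `F t η`, is the generator applied to `F
  -- t`.
  have h := HasDerivWithinAt.fun_sum (u := Finset.univ) fun η _ => (hder η).mul (hF η)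
  refine h.congr_deriv ?_
  rw [Finset.sum_add_distrib]
  simp only [mul_add, Finset.sum_add_distrib]
  congr 1
  simp only [Finset.sum_mul]
  rw [Finset.sum_comm]
  refine Finset.sum_congr rfl fun ζ _ => ?_
  simp only [mul_assoc, ← Finset.mul_sum]
  congr 1
  simp only [generator, Finset.sum_mul]
  rw [Finset.sum_comm]
  refine Finset.sum_congr rfl fun x _ => ?_
  simp only [mul_assoc, ← Finset.mul_sum]
  congr 1
  simp [f, sub_mul, Finset.sum_sub_distrib]

end ForwardEquation

/-- A Gronwall inequality for the supremum of a family of functions. -/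
lemma family_gronwall {I : Type*} {T C ε B : ℝ} (hT : 0 ≤ T) (hC : 0 < C) (hε : 0 ≤ ε)
    {Φ Φ' : I → ℝ → ℝ} (hB : ∀ i, ∀ t ∈ Icc 0 T, Φ i t ≤ B) (h0 : ∀ i, Φ i 0 = 0)
    (hd : ∀ i, ∀ t ∈ Icc 0 T, HasDerivWithinAt (Φ i) (Φ' i t) (Icc 0 T) t)
    (hΦ : ∀ t ∈ Icc 0 T, ∀ D, (∀ i, Φ i t ≤ D) → ∀ i, Φ' i t ≤ C * D + ε) (i : I) {t : ℝ}
    (ht : t ∈ Icc 0 T) : Φ i t ≤ 2 * ε * T * Real.exp (2 * C * T) := by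
  -- The supremum of the weighted family is never differentiated. With rate `2 * C`, integrating the
  -- bound on each member gives `M ≤ ε * T + M / 2`, which can be solved for the finite `M`.
  let f : I × Icc (0 : ℝ) T → ℝ := fun q => Real.exp (-(2 * C * q.2)) * Φ q.1 q.2
  have hfb : BddAbove (range f) := by
    refine ⟨max B 0, ?_⟩
    rintro _ ⟨q, rfl⟩
    have h1 : Real.exp (-(2 * C * q.2)) ≤ 1 := by
      rw [← Real.exp_zero, Real.exp_le_exp]
      have := mul_nonneg hC.le q.2.2.1
      linarith
    have h2 := (hB q.1 q.2 q.2.2).trans (le_max_left B 0)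
    have h3 := mul_le_mul_of_nonneg_left h2 (Real.exp_pos (-(2 * C * q.2))).le
    exact h3.trans (mul_le_of_le_one_left (le_max_right _ _) h1)
  set M := ⨆ q, f q with hM
  have hle : ∀ i, ∀ s ∈ Icc 0 T, Φ i s ≤ M * Real.exp (2 * C * s) := by
    intro k s hs
    have h1 : f (k, ⟨s, hs⟩) ≤ M := le_ciSup hfb _
    have h2 := mul_le_mul_of_nonneg_right h1 (Real.exp_pos (2 * C * s)).le
    have e : f (k, ⟨s, hs⟩) * Real.exp (2 * C * s) = Φ k s := by
      simp only [f]
      rw [mul_right_comm, ← Real.exp_add]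
      simp
    linarith
  have hM0 : 0 ≤ M := by
    have := hle i 0 (left_mem_Icc.2 hT)
    simpa [h0] using this
  have hkey : ∀ i, ∀ s ∈ Icc 0 T, Φ i s ≤ ε * s + M / 2 * (Real.exp (2 * C * s) - 1) := by
    intro k
    refine image_le_of_deriv_right_le_deriv_boundary
      (fun s hs => (hd k s hs).continuousWithinAt)
      (fun s hs => hasDerivWithinAt_Ici_of_Icc (hd k s (Ico_subset_Icc_self hs)) hs)
      (B' := fun s => ε + C * (M * Real.exp (2 * C * s))) (by simp [h0]) (by fun_prop)
      (fun s _ => ?_) (fun s hs => ?_)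
    · have h1 : HasDerivAt (fun s => ε * s + M / 2 * (Real.exp (2 * C * s) - 1))
          (ε * 1 + M / 2 * (Real.exp (2 * C * s) * (2 * C * 1))) s :=
        ((hasDerivAt_id s).const_mul ε).add
          ((((hasDerivAt_id s).const_mul (2 * C)).exp.sub_const 1).const_mul (M / 2))
      exact (h1.congr_deriv (by ring)).hasDerivWithinAt
    · have := hΦ s (Ico_subset_Icc_self hs) _ (fun k => hle k s (Ico_subset_Icc_self hs)) k
      linarith
  have hMle : M ≤ 2 * ε * T := by
    have : M ≤ ε * T + M / 2 := by
      have : Nonempty (I × Icc (0 : ℝ) T) := ⟨(i, ⟨t, ht⟩)⟩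
      refine ciSup_le fun q => ?_
      obtain ⟨k, s, hs⟩ := q
      have h1 := mul_le_mul_of_nonneg_left (hkey k s hs) (Real.exp_pos (-(2 * C * s))).le
      have e : Real.exp (-(2 * C * s)) * Real.exp (2 * C * s) = 1 := by
        rw [← Real.exp_add]; simp
      have h2 : Real.exp (-(2 * C * s)) ≤ 1 := by
        rw [← Real.exp_zero, Real.exp_le_exp]
        have := mul_nonneg hC.le hs.1
        linarith
      have h3 : Real.exp (-(2 * C * s)) * (ε * s) ≤ ε * T :=
        (mul_le_of_le_one_left (mul_nonneg hε hs.1) h2).trans (mul_le_mul_of_nonneg_left hs.2 hε)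
      have h4 : 0 ≤ M / 2 * Real.exp (-(2 * C * s)) := by positivity
      have e2 : Real.exp (-(2 * C * s)) * (ε * s + M / 2 * (Real.exp (2 * C * s) - 1)) =
          Real.exp (-(2 * C * s)) * (ε * s) + M / 2 *
            (Real.exp (-(2 * C * s)) * Real.exp (2 * C * s)) - M / 2 * Real.exp (-(2 * C * s)) := by
        ring
      rw [e2, e] at h1
      simp only [f]
      linarith
    linarith
  refine (hle i t ht).trans (mul_le_mul hMle ?_ (Real.exp_pos _).le (by positivity))
  exact Real.exp_le_exp.2 (mul_le_mul_of_nonneg_left ht.2 (by linarith))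

/-! ### Spin flips: energy differences, rates and the generator on squared deviations. -/

section Flip

variable {d n : ℕ}

lemma spin_sq (η : Config d n) (x : Site d n) : spin η x * spin η x = 1 := by
  rcases Int.units_eq_one_or (η x) with h | h <;> simp [spin, h]

lemma abs_spin (η : Config d n) (x : Site d n) : |spin η x| = 1 := by
  rcases Int.units_eq_one_or (η x) with h | h <;> simp [spin, h]

lemma spin_flipAt (η : Config d n) (x y : Site d n) :
    spin (flipAt η x) y = spin η y - if y = x then 2 * spin η x else 0 := by
  by_cases h : y = x
  · subst h
    simp [spin, flipAt]
    ring
  · simp [spin, flipAt, h]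

variable [NeZero n]

/-- The field acting on the spin at `x`. -/
noncomputable def microField (J : Torus d → ℝ) (θ : ℝ) (α : (Fin d → ℤ) → ℝ) (x : Site d n)
    (η : Config d n) : ℝ :=
  siteAvg (fun y => J (scalePt (x - y)) * spin η y) - ((n : ℝ)⁻¹) ^ d * J 0 * spin η x
    + θ * field α x

/-- Symmetry of `J` makes the row and the column of `x` contribute equally. The diagonal term does
not change under the flip, which is why `microField` subtracts the self-interaction. -/
lemma hamiltonian_flipAt_sub {J : Torus d → ℝ} (hJ : ∀ r, J (-r) = J r) (θ : ℝ)
    (α : (Fin d → ℤ) → ℝ) (x : Site d n) (η : Config d n) :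
    hamiltonian J θ α (flipAt η x) - hamiltonian J θ α η =
      2 * (spin η x * microField J θ α x η) := by
  set N := ((n : ℝ)⁻¹) ^ d with hN
  set K : Site d n → Site d n → ℝ := fun y z => N * J (scalePt (y - z)) with hK
  have hsymm : ∀ y z, K y z = K z y := by
    intro y z
    simp only [hK]
    rw [← neg_sub z y, ← zero_sub, scalePt_sub, scalePt_zero, zero_sub, hJ]
  have hquad : ∑ y, ∑ z, K y z * spin (flipAt η x) y * spin (flipAt η x) z =
      ∑ y, ∑ z, K y z * spin η y * spin η z - 4 * spin η x * ∑ z, K x z * spin η z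
        + 4 * K x x * (spin η x * spin η x) := by
    have e : ∀ y z, K y z * spin (flipAt η x) y * spin (flipAt η x) z =
        K y z * spin η y * spin η z - (if y = x then 2 * spin η x * (K y z * spin η z) else 0)
          - (if z = x then 2 * spin η x * (K y z * spin η y) else 0)
          + (if y = x then if z = x then 4 * K y z * (spin η x * spin η x) else 0 else 0) := by
      intro y z
      rw [spin_flipAt, spin_flipAt]
      split_ifs <;> ring
    have e1 : ∀ y : Site d n, ∑ z, (if y = x then 2 * spin η x * (K y z * spin η z) else 0) =
        if y = x then ∑ z, 2 * spin η x * (K y z * spin η z) else 0 := by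
      intro y; split_ifs <;> simp
    have e2 : ∀ y : Site d n,
        ∑ z, (if y = x then if z = x then 4 * K y z * (spin η x * spin η x) else 0 else 0) =
        if y = x then 4 * K y x * (spin η x * spin η x) else 0 := by
      intro y; split_ifs <;> simp
    simp only [e, Finset.sum_add_distrib, Finset.sum_sub_distrib, e1, e2, Finset.sum_ite_eq',
      Finset.mem_univ, if_true, ← Finset.mul_sum]
    have e3 : ∑ y, K y x * spin η y = ∑ y, K x y * spin η y :=
      Finset.sum_congr rfl fun y _ => by rw [hsymm y x]
    rw [e3]
    ring
  have hlin : ∑ y, field α y * spin (flipAt η x) y =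
      ∑ y, field α y * spin η y - 2 * field α x * spin η x := by
    simp only [spin_flipAt, mul_sub, mul_ite, mul_zero, Finset.sum_sub_distrib,
      Finset.sum_ite_eq', Finset.mem_univ, if_true]
    ring
  have hm : microField J θ α x η =
      ∑ z, K x z * spin η z - K x x * spin η x + θ * field α x := by
    simp only [microField, siteAvg, hK, sub_self, scalePt_zero, Finset.mul_sum, mul_assoc, ← hN]
  have hx := spin_sq η x
  simp only [hamiltonian]
  rw [← hN]
  change -(1 / 2) * ∑ y, ∑ z, K y z * spin (flipAt η x) y * spin (flipAt η x) z - _ -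
    (-(1 / 2) * ∑ y, ∑ z, K y z * spin η y * spin η z - _) = _
  rw [hquad, hlin, hm, hx]
  linear_combination (2 * K x x) * hx

/-- The perturbed rate in terms of the relaxation and forcing coefficients. -/
lemma perturbedRate_eq {J : Torus d → ℝ} (hJ : ∀ r, J (-r) = J r) (θ : ℝ) (a : Fin 2 → ℝ)
    (V : Fin 2 → ℝ → Torus d → ℝ) (α : (Fin d → ℤ) → ℝ) (x : Site d n) (η : Config d n) (t : ℝ) :
    perturbedRate J θ a V α x η t =
      (relax (potential a V α t x) (microField J θ α x η)
        - spin η x * force (potential a V α t x) (microField J θ α x η)) / 2 := by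
  set v := potential a V α t x
  set h := microField J θ α x η
  have hc := (Real.cosh_pos h).ne'
  rw [perturbedRate, rate, hamiltonian_flipAt_sub hJ, ← cosh_div_cosh, ← sinh_div_cosh]
  rcases Int.units_eq_one_or (η x) with hx | hx
  · have hs : spin η x = 1 := by simp [spin, hx]
    rw [hs]
    have e1 : -(1 / 2) * (2 * (1 * h)) = -h := by ring
    have e2 : (1 : ℝ) / 2 * (2 * (1 * h)) = h := by ring
    rw [e1, e2, ← mul_div_assoc, ← Real.exp_add, Real.cosh_eq (h + 2 * v), Real.sinh_eq]
    have e3 : -(1 * (2 * v)) + -h = -(h + 2 * v) := by ring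
    rw [e3]
    field_simp
    ring
  · have hs : spin η x = -1 := by simp [spin, hx]
    rw [hs]
    have e1 : -(1 / 2) * (2 * (-1 * h)) = h := by ring
    have e2 : (1 : ℝ) / 2 * (2 * (-1 * h)) = -h := by ring
    rw [e1, e2, Real.cosh_neg, ← mul_div_assoc, ← Real.exp_add, Real.cosh_eq (h + 2 * v),
      Real.sinh_eq]
    have e3 : -(-1 * (2 * v)) + h = h + 2 * v := by ring
    rw [e3]
    field_simp
    ring

/-- The lattice average against `g` of the deviation of the spins from the profile `u`. -/
noncomputable def deviation (g u : Site d n → ℝ) (η : Config d n) : ℝ :=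
  siteAvg fun x => g x * (spin η x - u x)

lemma deviation_flipAt (g u : Site d n → ℝ) (η : Config d n) (x : Site d n) :
    deviation g u (flipAt η x) = deviation g u η - ((n : ℝ)⁻¹) ^ d * (2 * g x * spin η x) := by
  have e : ∀ y, g y * (spin (flipAt η x) y - u y) =
      g y * (spin η y - u y) - if y = x then 2 * g y * spin η x else 0 := by
    intro y; rw [spin_flipAt]; split_ifs <;> ring
  simp only [deviation, siteAvg, e, Finset.sum_sub_distrib, Finset.sum_ite_eq', Finset.mem_univ,
    if_true, mul_sub]

lemma deviation_smul (b : ℝ) (g u : Site d n → ℝ) (η : Config d n) :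
    deviation (fun x => b * g x) u η = b * deviation g u η := by
  simp only [deviation, mul_assoc, siteAvg_mul_left]

/-- A flip at `x` changes the deviation by `-2 n⁻ᵈ g(x) σ(x)`, and `-2 σ(x)` times the rate is
`force - σ(x) * relax`. The squares of the jumps give the second term, which is of order `n⁻ᵈ`. -/
lemma generator_deviation_sq {J : Torus d → ℝ} (hJ : ∀ r, J (-r) = J r) (θ : ℝ) (a : Fin 2 → ℝ)
    (V : Fin 2 → ℝ → Torus d → ℝ) (α : (Fin d → ℤ) → ℝ) (t : ℝ) (g u : Site d n → ℝ)
    (η : Config d n) :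
    generator J θ a V α t (fun ζ => deviation g u ζ ^ 2) η =
      2 * deviation g u η * siteAvg (fun x => g x *
        (force (potential a V α t x) (microField J θ α x η)
          - spin η x * relax (potential a V α t x) (microField J θ α x η)))
      + 4 * ((n : ℝ)⁻¹) ^ d * siteAvg (fun x => g x ^ 2 * perturbedRate J θ a V α x η t) := by
  simp only [siteAvg, Finset.mul_sum]
  rw [← Finset.sum_add_distrib, generator]
  refine Finset.sum_congr rfl fun x _ => ?_
  rw [deviation_flipAt]
  set Y := deviation g u η
  set N := ((n : ℝ)⁻¹) ^ d
  set A := relax (potential a V α t x) (microField J θ α x η) with hA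
  set B := force (potential a V α t x) (microField J θ α x η) with hB
  have h1 := perturbedRate_eq hJ θ a V α x η t
  rw [← hA, ← hB] at h1
  have h2 := spin_sq η x
  rw [h1]
  linear_combination (N * g x * Y * 2 * B + 4 * N ^ 2 * g x ^ 2 * (A - spin η x * B) / 2) * h2

end Flip

/-! ### The closed second-moment estimate. -/

section SecondMoment

variable {d n : ℕ} [NeZero n] {T : ℝ} {J : Torus d → ℝ} {θ : ℝ} {a : Fin 2 → ℝ}
  {V : Fin 2 → ℝ → Torus d → ℝ} {α : (Fin d → ℤ) → ℝ}

lemma siteAvg_congr {f g : Site d n → ℝ} (h : ∀ x, f x = g x) : siteAvg f = siteAvg g := by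
  rw [funext h]

lemma perturbedRate_le (hJ : ∀ r, J (-r) = J r) {t c : ℝ} {x : Site d n}
    (hc : |potential a V α t x| ≤ c) (η : Config d n) :
    perturbedRate J θ a V α x η t ≤ Real.exp (2 * c) := by
  rw [perturbedRate_eq hJ]
  have h1 := relax_le hc (microField J θ α x η)
  have h2 := abs_force_le hc (microField J θ α x η)
  have h3 : |spin η x * force (potential a V α t x) (microField J θ α x η)| ≤ Real.exp (2 * c) := by
    rwa [abs_mul, abs_spin, one_mul]
  linarith [(abs_le.1 h3).1]

/-- The drift of the squared deviation from a profile that relaxes along the field `hbar`. -/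
lemma drift_deviation_sq_le (hJ : ∀ r, J (-r) = J r) {j : ℝ} (hj1 : 0 < j) {t c κ : ℝ}
    (hc : ∀ x : Site d n, |potential a V α t x| ≤ c) {u hbar g : Site d n → ℝ}
    (hg : ∀ x, |g x| ≤ 1) (η : Config d n)
    (hκ : ∀ x, |microField J θ α x η - deviation (fun y => J (scalePt (x - y))) u η - hbar x| ≤ κ) :
    generator J θ a V α t (fun ζ => deviation g u ζ ^ 2) η
      + 2 * deviation g u η * -siteAvg (fun x => g x *
        (force (potential a V α t x) (hbar x) - u x * relax (potential a V α t x) (hbar x)))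
      ≤ 2 * deviation g u η ^ 2
        + Real.exp (2 * c) ^ 2 *
          deviation (fun x => g x * relax (potential a V α t x) (hbar x) / Real.exp (2 * c)) u η ^ 2
        + 2 * Real.exp (2 * c) ^ 2 * j ^ 2 *
          siteAvg (fun x => deviation (fun y => J (scalePt (x - y)) / j) u η ^ 2)
        + (2 * Real.exp (2 * c) ^ 2 * κ ^ 2 + 4 * ((n : ℝ)⁻¹) ^ d * Real.exp (2 * c)) := by
  set E := Real.exp (2 * c) with hE
  have hE0 : 0 < E := Real.exp_pos _
  set v := fun x : Site d n => potential a V α t x with hv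
  set h := fun x : Site d n => microField J θ α x η with hh
  set Y := deviation g u η with hY
  -- `e` is the error from replacing the microscopic field by `hbar` with the spin kept fixed. What
  -- then remains of the drift difference is `-relax * (σ - u)`, linear in the deviation.
  set e : Site d n → ℝ := fun x =>
    (force (v x) (h x) - spin η x * relax (v x) (h x))
      - (force (v x) (hbar x) - spin η x * relax (v x) (hbar x)) with he
  -- Division by `E ≥ relax` makes this a deviation whose weight is again bounded by one; division
  -- of `J` by `j` below serves the same purpose.
  set Z := deviation (fun x => g x * relax (v x) (hbar x) / E) u η with hZ
  have hEZ : siteAvg (fun x => g x * relax (v x) (hbar x) * (spin η x - u x)) = E * Z := by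
    rw [hZ, ← deviation_smul]
    exact siteAvg_congr fun x => by field_simp
  have hsplit : siteAvg (fun x => g x * (force (v x) (h x) - spin η x * relax (v x) (h x)))
      - siteAvg (fun x => g x * (force (v x) (hbar x) - u x * relax (v x) (hbar x))) =
      siteAvg (fun x => g x * e x) - E * Z := by
    rw [← hEZ, ← siteAvg_sub, ← siteAvg_sub]
    exact siteAvg_congr fun x => by simp only [he]; ring
  have hesq : siteAvg (fun x => g x * e x) ^ 2 ≤ 2 * E ^ 2 * j ^ 2 *
      siteAvg (fun x => deviation (fun y => J (scalePt (x - y)) / j) u η ^ 2)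
      + 2 * E ^ 2 * κ ^ 2 := by
    refine (sq_siteAvg_le _).trans ?_
    rw [← siteAvg_const (d := d) (n := n) (2 * E ^ 2 * κ ^ 2), ← siteAvg_mul_left, ← siteAvg_add]
    refine siteAvg_mono fun x => ?_
    set W := deviation (fun y => J (scalePt (x - y)) / j) u η
    have hW : deviation (fun y => J (scalePt (x - y))) u η = j * W := by
      rw [← deviation_smul]
      exact siteAvg_congr fun y => by field_simp
    have h1 : |e x| ≤ E * |h x - hbar x| :=
      abs_force_sub_mul_relax_sub_le (hc x) (abs_spin η x).le _ _
    have h2 : |h x - hbar x| ≤ |j * W| + κ := by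
      have h3 := hκ x
      rw [hW] at h3
      have h4 := abs_add_le (j * W) (h x - j * W - hbar x)
      have h5 : j * W + (h x - j * W - hbar x) = h x - hbar x := by ring
      rw [h5] at h4
      linarith
    have h3 : (g x * e x) ^ 2 ≤ e x ^ 2 := by
      rw [mul_pow]
      exact mul_le_of_le_one_left (sq_nonneg _) ((sq_le_one_iff_abs_le_one _).2 (hg x))
    have h4 : e x ^ 2 ≤ (E * (|j * W| + κ)) ^ 2 := by
      rw [← sq_abs (e x)]
      exact pow_le_pow_left₀ (abs_nonneg _)
        (h1.trans (mul_le_mul_of_nonneg_left h2 hE0.le)) 2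
    have h5 : (|j * W| + κ) ^ 2 ≤ 2 * (j * W) ^ 2 + 2 * κ ^ 2 := by
      rw [← sq_abs (j * W)]
      nlinarith [sq_nonneg (|j * W| - κ)]
    have h6 := mul_le_mul_of_nonneg_left h5 (sq_nonneg E)
    calc (g x * e x) ^ 2 ≤ (E * (|j * W| + κ)) ^ 2 := h3.trans h4
      _ = E ^ 2 * (|j * W| + κ) ^ 2 := mul_pow _ _ _
      _ ≤ _ := h6
      _ = _ := by ring
  have hrate : siteAvg (fun x => g x ^ 2 * perturbedRate J θ a V α x η t) ≤ E := by
    rw [← siteAvg_const (d := d) (n := n) E]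
    refine siteAvg_mono fun x => ?_
    have h1 : g x ^ 2 ≤ 1 := (sq_le_one_iff_abs_le_one _).2 (hg x)
    have h2 := perturbedRate_le (θ := θ) hJ (hc x) η
    have h3 := mul_le_mul_of_nonneg_left h2 (sq_nonneg (g x))
    exact h3.trans (mul_le_of_le_one_left hE0.le h1)
  have hrate' := mul_le_mul_of_nonneg_left hrate
    (by positivity : 0 ≤ 4 * ((n : ℝ)⁻¹) ^ d)
  rw [generator_deviation_sq hJ]
  change 2 * Y * siteAvg (fun x => g x * (force (v x) (h x) - spin η x * relax (v x) (h x))) + _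
    + 2 * Y * -siteAvg (fun x => g x * (force (v x) (hbar x) - u x * relax (v x) (hbar x))) ≤ _
  have hmain : 2 * Y * (siteAvg (fun x => g x * e x) - E * Z) ≤
      2 * Y ^ 2 + E ^ 2 * Z ^ 2 + siteAvg (fun x => g x * e x) ^ 2 := by
    nlinarith [sq_nonneg (Y - siteAvg (fun x => g x * e x)), sq_nonneg (Y + E * Z)]
  rw [← hsplit] at hmain
  linarith

/-- Mean-square closeness of the particle system to a profile that relaxes along an
approximation of the microscopic field. -/
lemma IsGlauberLaw.deviation_sq_le {σ₀ : Config d n} {Q : Measure (PathSpace d n T)} {hT : 0 ≤ T}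
    (hQ : IsGlauberLaw J θ a V α hT σ₀ Q) (hJ : ∀ r, J (-r) = J r)
    (hV : ∀ i r, Continuous fun s => V i s r) {j : ℝ} (hj0 : 0 < j) (hj : ∀ r, |J r| ≤ j) {c κ : ℝ}
    (hc : ∀ t ∈ Icc 0 T, ∀ x : Site d n, |potential a V α t x| ≤ c)
    {u hbar : Site d n → ℝ → ℝ} (hu0 : ∀ x, u x 0 = spin σ₀ x)
    (hu : ∀ x, ∀ t ∈ Icc 0 T, HasDerivWithinAt (u x)
      (force (potential a V α t x) (hbar x t) - u x t * relax (potential a V α t x) (hbar x t))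
      (Icc 0 T) t)
    (hκ : ∀ t ∈ Icc 0 T, ∀ x η, |microField J θ α x η
      - deviation (fun y => J (scalePt (x - y))) (fun y => u y t) η - hbar x t| ≤ κ)
    {g : Site d n → ℝ} (hg : ∀ x, |g x| ≤ 1) {t : ℝ} (ht : t ∈ Icc 0 T) :
    ∑ η, marginal hT Q t η * deviation g (fun x => u x t) η ^ 2 ≤
      2 * (2 * Real.exp (2 * c) ^ 2 * κ ^ 2 + 4 * ((n : ℝ)⁻¹) ^ d * Real.exp (2 * c)) * T *
        Real.exp (2 * (2 + Real.exp (2 * c) ^ 2 + 2 * Real.exp (2 * c) ^ 2 * j ^ 2) * T) := by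
  have := hQ.1
  set E := Real.exp (2 * c) with hE
  have hE0 : 0 < E := Real.exp_pos _
  have hsum := sum_marginal hT Q
  have hpos := marginal_nonneg hT Q
  -- `B` only makes the supremum in `family_gronwall` finite; it does not enter the final estimate.
  have hB : ∃ B, ∀ x, ∀ s ∈ Icc 0 T, |u x s| ≤ B := by
    have h1 : ∀ x, ∃ B, ∀ s ∈ Icc 0 T, |u x s| ≤ B := fun x =>
      isCompact_Icc.exists_bound_of_continuousOn fun s hs => (hu x s hs).continuousWithinAt
    choose B hB using h1
    exact ⟨∑ x, |B x|, fun x s hs => (hB x s hs).trans ((le_abs_self _).trans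
      (Finset.single_le_sum (f := fun x => |B x|) (fun x _ => abs_nonneg _) (Finset.mem_univ x)))⟩
  obtain ⟨B, hB⟩ := hB
  -- Indexing by all weights bounded by one closes the estimate: the weights `g * relax / E` and
  -- `J(γ(x - ·)) / j` belong to the same family.
  let I := {g : Site d n → ℝ // ∀ x, |g x| ≤ 1}
  let w : I → ℝ → Site d n → ℝ := fun k s x =>
    k.1 x * (force (potential a V α s x) (hbar x s) - u x s * relax (potential a V α s x) (hbar x s))
  refine family_gronwall (I := I) (B := (1 + B) ^ 2)
    (Φ := fun k s => ∑ η, marginal hT Q s η * deviation k.1 (fun x => u x s) η ^ 2)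
    (Φ' := fun k s => ∑ η, marginal hT Q s η *
      (generator J θ a V α s (fun ζ => deviation k.1 (fun x => u x s) ζ ^ 2) η
        + 2 * deviation k.1 (fun x => u x s) η * -siteAvg (w k s)))
    hT (by positivity) (by positivity) ?_ ?_ ?_ ?_ ⟨g, hg⟩ ht
  · intro k s hs
    have h1 : ∀ η, deviation k.1 (fun x => u x s) η ^ 2 ≤ (1 + B) ^ 2 := by
      intro η
      rw [← sq_abs]
      refine pow_le_pow_left₀ (abs_nonneg _) (abs_siteAvg_le_of_le fun x => ?_) 2
      rw [abs_mul]
      refine (mul_le_of_le_one_left (abs_nonneg _) (k.2 x)).trans ((abs_sub _ _).trans ?_)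
      rw [abs_spin]
      linarith [hB x s hs]
    calc _ ≤ ∑ η, marginal hT Q s η * (1 + B) ^ 2 :=
          Finset.sum_le_sum fun η _ => mul_le_mul_of_nonneg_left (h1 η) (hpos s η)
      _ = (1 + B) ^ 2 := by rw [← Finset.sum_mul, hsum, one_mul]
  · intro k
    rw [hQ.marginal_zero (fun η => deviation k.1 (fun x => u x 0) η ^ 2)]
    simp [deviation, hu0, siteAvg]
  · intro k s hs
    refine hQ.hasDerivWithinAt_sum hV (F := fun s η => deviation k.1 (fun x => u x s) η ^ 2)
      (F' := fun s η => 2 * deviation k.1 (fun x => u x s) η * -siteAvg (w k s)) hs fun η => ?_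
    have h1 : HasDerivWithinAt (fun s => deviation k.1 (fun x => u x s) η) (-siteAvg (w k s))
        (Icc 0 T) s := by
      have h2 := (HasDerivWithinAt.fun_sum (u := Finset.univ) fun x _ =>
        ((hu x s hs).const_sub (spin η x)).const_mul (k.1 x)).const_mul (((n : ℝ)⁻¹) ^ d)
      refine h2.congr_deriv ?_
      simp only [siteAvg, w, ← mul_neg, ← Finset.sum_neg_distrib]
    exact (h1.pow 2).congr_deriv (by simp)
  · intro s hs D hD k
    have hD1 : ∀ g' : Site d n → ℝ, (∀ x, |g' x| ≤ 1) →
        ∑ η, marginal hT Q s η * deviation g' (fun x => u x s) η ^ 2 ≤ D :=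
      fun g' hg' => hD ⟨g', hg'⟩
    have hA := hD1 (fun x => k.1 x * relax (potential a V α s x) (hbar x s) / E) fun x => by
      rw [abs_div, abs_mul, abs_of_pos hE0, abs_of_pos (relax_pos _ _), div_le_one hE0]
      exact (mul_le_of_le_one_left (relax_pos _ _).le (k.2 x)).trans (relax_le (hc s hs x) _)
    have hJD : ∑ η, marginal hT Q s η * siteAvg (fun x : Site d n =>
        deviation (fun y => J (scalePt (x - y)) / j) (fun x => u x s) η ^ 2) ≤ D := by
      have e : ∑ η, marginal hT Q s η * siteAvg (fun x : Site d n =>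
          deviation (fun y => J (scalePt (x - y)) / j) (fun x => u x s) η ^ 2) =
          siteAvg (fun x : Site d n => ∑ η, marginal hT Q s η *
            deviation (fun y => J (scalePt (x - y)) / j) (fun x => u x s) η ^ 2) := by
        simp only [siteAvg, Finset.mul_sum]
        rw [Finset.sum_comm]
        exact Finset.sum_congr rfl fun x _ => Finset.sum_congr rfl fun η _ => by ring
      rw [e, ← siteAvg_const (d := d) (n := n) D]
      refine siteAvg_mono fun x => hD1 _ fun y => ?_
      rw [abs_div, abs_of_pos hj0, div_le_one hj0]
      exact hj _
    set ε := 2 * E ^ 2 * κ ^ 2 + 4 * ((n : ℝ)⁻¹) ^ d * E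
    calc _ ≤ ∑ η, marginal hT Q s η *
          (2 * deviation k.1 (fun x => u x s) η ^ 2
          + E ^ 2 * deviation (fun x => k.1 x * relax (potential a V α s x) (hbar x s) / E)
            (fun x => u x s) η ^ 2
          + 2 * E ^ 2 * j ^ 2 * siteAvg (fun x : Site d n =>
            deviation (fun y => J (scalePt (x - y)) / j) (fun x => u x s) η ^ 2) + ε) :=
        Finset.sum_le_sum fun η _ => mul_le_mul_of_nonneg_left
          (drift_deviation_sq_le hJ hj0 (hc s hs) k.2 η (fun x => hκ s hs x η)) (hpos s η)
      _ = 2 * (∑ η, marginal hT Q s η * deviation k.1 (fun x => u x s) η ^ 2)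
          + E ^ 2 * (∑ η, marginal hT Q s η *
            deviation (fun x => k.1 x * relax (potential a V α s x) (hbar x s) / E)
              (fun x => u x s) η ^ 2)
          + 2 * E ^ 2 * j ^ 2 * (∑ η, marginal hT Q s η * siteAvg (fun x : Site d n =>
            deviation (fun y => J (scalePt (x - y)) / j) (fun x => u x s) η ^ 2))
          + ε * ∑ η, marginal hT Q s η := by
        simp only [Finset.mul_sum, ← Finset.sum_add_distrib]
        exact Finset.sum_congr rfl fun η _ => by ring
      _ ≤ 2 * D + E ^ 2 * D + 2 * E ^ 2 * j ^ 2 * D + ε * 1 := by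
        rw [hsum]
        gcongr
        exact hD k
      _ = _ := by ring

end SecondMoment

/-! ### Linear scalar equations depending on a parameter. -/

section LinearEquation

variable {X : Type*} {A B : ℝ → X → ℝ}

/-- The propagator of the linear equation `f' = B - A f`. -/
noncomputable def decay (A : ℝ → X → ℝ) (s : ℝ) (r : X) : ℝ :=
  Real.exp (-∫ τ in (0 : ℝ)..s, A τ r)

/-- The solution of `f' = B - A f` that starts from zero. -/
noncomputable def source (A B : ℝ → X → ℝ) (s : ℝ) (r : X) : ℝ :=
  decay A s r * ∫ τ in (0 : ℝ)..s, (decay A τ r)⁻¹ * B τ r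

lemma decay_zero (r : X) : decay A 0 r = 1 := by simp [decay]

lemma source_zero (r : X) : source A B 0 r = 0 := by simp [source]

lemma decay_pos (s : ℝ) (r : X) : 0 < decay A s r := Real.exp_pos _

variable [TopologicalSpace X]

lemma continuous_decay (hA : Continuous (Function.uncurry A)) :
    Continuous (Function.uncurry (decay A)) := by
  have h : Continuous fun q : ℝ × X => ∫ τ in (0 : ℝ)..q.1, A τ q.2 :=
    intervalIntegral.continuous_parametric_intervalIntegral_of_continuous
      (f := fun (q : ℝ × X) τ => A τ q.2)
      (hA.comp (by fun_prop : Continuous fun z : (ℝ × X) × ℝ => (z.2, z.1.2))) continuous_fst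
  exact Real.continuous_exp.comp h.neg

lemma continuous_inv_decay_mul (hA : Continuous (Function.uncurry A))
    (hB : Continuous (Function.uncurry B)) :
    Continuous fun q : ℝ × X => (decay A q.1 q.2)⁻¹ * B q.1 q.2 :=
  ((continuous_decay hA).inv₀ fun q => (decay_pos q.1 q.2).ne').mul hB

lemma continuous_source (hA : Continuous (Function.uncurry A))
    (hB : Continuous (Function.uncurry B)) : Continuous (Function.uncurry (source A B)) := by
  have h : Continuous fun q : ℝ × X => ∫ τ in (0 : ℝ)..q.1, (decay A τ q.2)⁻¹ * B τ q.2 :=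
    intervalIntegral.continuous_parametric_intervalIntegral_of_continuous
      (f := fun (q : ℝ × X) τ => (decay A τ q.2)⁻¹ * B τ q.2)
      ((continuous_inv_decay_mul hA hB).comp
        (by fun_prop : Continuous fun z : (ℝ × X) × ℝ => (z.2, z.1.2))) continuous_fst
  exact (continuous_decay hA).mul h

lemma hasDerivAt_linear (hA : Continuous (Function.uncurry A))
    (hB : Continuous (Function.uncurry B)) (z s : ℝ) (r : X) :
    HasDerivAt (fun s => z * decay A s r + source A B s r)
      (B s r - (z * decay A s r + source A B s r) * A s r) s := by
  have hAr : Continuous fun τ => A τ r := hA.comp (by fun_prop : Continuous fun τ : ℝ => (τ, r))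
  have hBr : Continuous fun τ => (decay A τ r)⁻¹ * B τ r :=
    (continuous_inv_decay_mul hA hB).comp (by fun_prop : Continuous fun τ : ℝ => (τ, r))
  have h1 : HasDerivAt (fun s => decay A s r) (decay A s r * -A s r) s :=
    ((hAr.integral_hasStrictDerivAt 0 s).hasDerivAt.neg).exp
  have h2 := h1.mul (hBr.integral_hasStrictDerivAt 0 s).hasDerivAt
  refine ((h1.const_mul z).add h2).congr_deriv ?_
  have := (decay_pos (A := A) s r).ne'
  simp only [source]
  field_simp
  ring

/-- Initial value and forcing both carry the factor `q`, which linearity pulls out. The same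
propagator and source thus serve the limit, where `q = p i`, and the single spins, where `q` is
absent. -/
lemma eq_linear_of_hasDerivWithinAt (hA : Continuous (Function.uncurry A))
    (hB : Continuous (Function.uncurry B)) {T q z : ℝ} {r : X} {f : ℝ → ℝ} (h0 : f 0 = q * z)
    (hf : ∀ t ∈ Icc 0 T, HasDerivWithinAt f (-f t * A t r + q * B t r) (Icc 0 T) t) :
    ∀ t ∈ Icc 0 T, f t = q * (z * decay A t r + source A B t r) := by
  have hAr : Continuous fun τ => A τ r := hA.comp (by fun_prop : Continuous fun τ : ℝ => (τ, r))
  obtain ⟨K, hK⟩ := (isCompact_Icc (a := (0 : ℝ)) (b := T)).exists_bound_of_continuousOn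
    hAr.continuousOn
  have hder : ∀ t ∈ Icc 0 T, HasDerivWithinAt
      (fun t => f t - q * (z * decay A t r + source A B t r))
      (-A t r * (f t - q * (z * decay A t r + source A B t r))) (Icc 0 T) t := fun t ht =>
    ((hf t ht).sub (((hasDerivAt_linear hA hB z t r).hasDerivWithinAt).const_mul q)).congr_deriv
      (by ring)
  have := eq_zero_of_abs_deriv_le_mul_abs_self_of_eq_zero_right (K := K)
    (fun t ht => (hder t ht).continuousWithinAt)
    (fun t ht => hasDerivWithinAt_Ici_of_Icc (hder t (Ico_subset_Icc_self ht)) ht)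
    (by simp [h0, decay_zero, source_zero])
    (fun t ht => by
      rw [norm_mul, norm_neg]
      exact mul_le_mul_of_nonneg_right (hK t (Ico_subset_Icc_self ht)) (norm_nonneg _))
  exact fun t ht => sub_eq_zero.1 (this t ht)

end LinearEquation

/-! ### Linearisation along the limiting field. -/

section Hydrodynamics

variable {d : ℕ} {J : Torus d → ℝ} {θ T : ℝ} {a p : Fin 2 → ℝ} {V : Fin 2 → ℝ → Torus d → ℝ}
  {m₀ : Torus d → ℝ} {α : (Fin d → ℤ) → ℝ}

lemma colour_eq {n : ℕ} (ha : a 0 ≠ a 1) {x : Site d n} {i : Fin 2} (hi : field α x = a i)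
    (k : Fin 2) : colour a α k x = if k = i then 1 else 0 := by
  have hinj : a i = a k ↔ k = i := by
    fin_cases i <;> fin_cases k <;> simp [ha, ha.symm]
  simp only [colour, hi, hinj]

/-- The field of the limiting profile `u`, with time projected to `[0, T]`. -/
noncomputable def limitField (J : Torus d → ℝ) (θ : ℝ) (a : Fin 2 → ℝ) (hT : 0 ≤ T)
    (u : Fin 2 → ℝ → C(Torus d, ℝ)) (i : Fin 2) (s : ℝ) (r : Torus d) : ℝ :=
  localField J θ a i (fun k => u k (projIcc 0 T hT s)) r

lemma IsContinuousSolution.continuous_limitField {u : Fin 2 → ℝ → C(Torus d, ℝ)}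
    (hu : IsContinuousSolution J θ a p V T m₀ u) (hJ : Continuous J) (hT : 0 ≤ T) (i : Fin 2) :
    Continuous (Function.uncurry (limitField J θ a hT u i)) := by
  have h1 : ∀ k, Continuous fun s => u k (projIcc 0 T hT s) := by
    intro k
    have h2 : ContinuousOn (u k) (Icc 0 T) := fun t ht => by
      obtain ⟨D, -, hD⟩ := hu.deriv k t ht
      exact hD.continuousWithinAt
    exact h2.comp_continuous (continuous_subtype_val.comp continuous_projIcc)
      fun s => (projIcc 0 T hT s).2
  have h2 : Continuous (Function.uncurry fun (s : ℝ) (r : Torus d) =>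
      u 0 (projIcc 0 T hT s) r + u 1 (projIcc 0 T hT s) r) := by
    have h3 : ∀ k, Continuous fun q : ℝ × Torus d => u k (projIcc 0 T hT q.1) q.2 := fun k =>
      ((h1 k).comp continuous_fst).eval continuous_snd
    exact (h3 0).add (h3 1)
  exact (continuous_torusConv_param hJ h2).add continuous_const

/-- Along the field of the limiting profile, the equation is linear, with propagator `D` and
inhomogeneous part `S`. -/
structure IsCharacteristic (J : Torus d → ℝ) (θ : ℝ) (a p : Fin 2 → ℝ)
    (V : Fin 2 → ℝ → Torus d → ℝ) {T : ℝ} (hT : 0 ≤ T) (m₀ : Torus d → ℝ)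
    (u : Fin 2 → ℝ → C(Torus d, ℝ)) (D S : Fin 2 → C(ℝ, C(Torus d, ℝ))) : Prop where
  propagator_zero : ∀ i r, D i 0 r = 1
  inhomogeneous_zero : ∀ i r, S i 0 r = 0
  eq : ∀ i, ∀ s ∈ Icc 0 T, ∀ r, u i s r = p i * (m₀ r * D i s r + S i s r)
  -- Every `z` is allowed, since the lattice profile starts from `z = ±1` while the limit starts
  -- from `m₀ r`.
  deriv : ∀ i z s r, HasDerivAt (fun s => z * D i s r + S i s r)
    (force (V i s r) (limitField J θ a hT u i s r)
      - (z * D i s r + S i s r) * relax (V i s r) (limitField J θ a hT u i s r)) s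

lemma continuous_uncurry_comp₂ {f : ℝ → ℝ → ℝ} (hf : Continuous fun q : ℝ × ℝ => f q.1 q.2)
    {v h : ℝ → Torus d → ℝ} (hv : Continuous (Function.uncurry v))
    (hh : Continuous (Function.uncurry h)) :
    Continuous (Function.uncurry fun s r => f (v s r) (h s r)) :=
  hf.comp (hv.prodMk hh)

lemma IsContinuousSolution.eq_linear {u : Fin 2 → ℝ → C(Torus d, ℝ)}
    (hu : IsContinuousSolution J θ a p V T m₀ u) (hT : 0 ≤ T) (i : Fin 2)
    {A B : ℝ → Torus d → ℝ} (hA : Continuous (Function.uncurry A))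
    (hB : Continuous (Function.uncurry B))
    (hAeq : ∀ s r, A s r = relax (V i s r) (limitField J θ a hT u i s r))
    (hBeq : ∀ s r, B s r = force (V i s r) (limitField J θ a hT u i s r)) {s : ℝ}
    (hs : s ∈ Icc 0 T) (r : Torus d) :
    u i s r = p i * (m₀ r * decay A s r + source A B s r) := by
  refine eq_linear_of_hasDerivWithinAt (f := fun s => u i s r) hA hB (hu.init i r)
    (fun s hs => ?_) s hs
  obtain ⟨D, hD, hDer⟩ := hu.deriv i s hs
  refine (((ContinuousMap.evalCLM ℝ r).hasFDerivAt).comp_hasDerivWithinAt s hDer).congr_deriv ?_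
  refine (hD r).trans ?_
  rw [hAeq, hBeq, scalarDrift, limitField, projIcc_of_mem hT hs]

lemma IsContinuousSolution.exists_isCharacteristic {u : Fin 2 → ℝ → C(Torus d, ℝ)}
    (hu : IsContinuousSolution J θ a p V T m₀ u) (hJ : Continuous J) (hT : 0 ≤ T)
    (hV : ∀ i, Continuous (Function.uncurry (V i))) :
    ∃ D S, IsCharacteristic J θ a p V hT m₀ u D S := by
  have hH := hu.continuous_limitField hJ hT
  obtain ⟨A, hAeq⟩ : ∃ A : Fin 2 → ℝ → Torus d → ℝ, ∀ i s r,
    A i s r = relax (V i s r) (limitField J θ a hT u i s r) := ⟨_, fun _ _ _ => rfl⟩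
  obtain ⟨B, hBeq⟩ : ∃ B : Fin 2 → ℝ → Torus d → ℝ, ∀ i s r,
    B i s r = force (V i s r) (limitField J θ a hT u i s r) := ⟨_, fun _ _ _ => rfl⟩
  have hA : ∀ i, Continuous (Function.uncurry (A i)) := fun i => by
    rw [show A i = _ from funext₂ (hAeq i)]
    exact continuous_uncurry_comp₂ continuous_relax (hV i) (hH i)
  have hB : ∀ i, Continuous (Function.uncurry (B i)) := fun i => by
    rw [show B i = _ from funext₂ (hBeq i)]
    exact continuous_uncurry_comp₂ continuous_force (hV i) (hH i)
  refine ⟨fun i => ContinuousMap.curry ⟨_, continuous_decay (hA i)⟩,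
    fun i => ContinuousMap.curry ⟨_, continuous_source (hA i) (hB i)⟩,
    fun i r => decay_zero r, fun i r => source_zero r,
    fun i s hs r => hu.eq_linear hT i (hA i) (hB i) (hAeq i) (hBeq i) hs r, fun i z s r => ?_⟩
  rw [← hAeq, ← hBeq]
  exact hasDerivAt_linear (hA i) (hB i) z s r

end Hydrodynamics

/-! ### The lattice profile and its convergence to the limit. -/

section SiteProfile

variable {d : ℕ} {J : Torus d → ℝ} {θ T : ℝ} {a p : Fin 2 → ℝ} {V : Fin 2 → ℝ → Torus d → ℝ}
  {m₀ : Torus d → ℝ} {α : (Fin d → ℤ) → ℝ} {u : Fin 2 → ℝ → C(Torus d, ℝ)}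
  {D S : Fin 2 → C(ℝ, C(Torus d, ℝ))} {σ₀ : ∀ k : ℕ, Config d (2 * k + 1)}

lemma exists_field_eq {n : ℕ} (hα : ∀ z, ∃ i, α z = a i) (x : Site d n) :
    ∃ i, field α x = a i := hα _

/-- The profile on the lattice that starts from the configuration `σ` and relaxes along the
limiting field. -/
noncomputable def siteProfile {n : ℕ} [NeZero n] (a : Fin 2 → ℝ) (α : (Fin d → ℤ) → ℝ)
    (D S : Fin 2 → C(ℝ, C(Torus d, ℝ))) (σ : Config d n) (x : Site d n) (s : ℝ) : ℝ :=
  ∑ i, colour a α i x * (spin σ x * D i s (scalePt x) + S i s (scalePt x))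

lemma siteProfile_eq {n : ℕ} [NeZero n] (ha : a 0 ≠ a 1) {x : Site d n} {i : Fin 2}
    (hi : field α x = a i) (σ : Config d n) (s : ℝ) :
    siteProfile a α D S σ x s = spin σ x * D i s (scalePt x) + S i s (scalePt x) := by
  simp [siteProfile, colour_eq ha hi]

lemma sum_colour {n : ℕ} (ha : a 0 ≠ a 1) (hα : ∀ z, ∃ i, α z = a i) (x : Site d n) :
    ∑ i, colour a α i x = 1 := by
  obtain ⟨i, hi⟩ := exists_field_eq hα x
  simp [colour_eq ha hi]

/-- The error in replacing the coloured lattice average against `φ` of the lattice profile by the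
integral against the limiting profile. -/
noncomputable def profileError (a p : Fin 2 → ℝ) (α : (Fin d → ℤ) → ℝ)
    (σ₀ : ∀ k : ℕ, Config d (2 * k + 1)) (m₀ : Torus d → ℝ) (D S : Fin 2 → C(ℝ, C(Torus d, ℝ)))
    (k : ℕ) (i : Fin 2) (s : ℝ) (φ : C(Torus d, ℝ)) : ℝ :=
  colouredError a p α i (fun k => spin (σ₀ k)) m₀ k (φ * D i s) +
    colouredError a p α i (fun _ _ => 1) (fun _ => 1) k (φ * S i s)

/-- Profile and limit are affine in their initial data with the same coefficients. The error at time
`s` is therefore an error at time zero, with test functions `φ * D i s` and `φ * S i s`. -/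
lemma siteAvg_siteProfile_sub (hm₀ : Continuous m₀) (ha : a 0 ≠ a 1)
    (hα : ∀ z, ∃ i, α z = a i) {s : ℝ}
    (hus : ∀ i r, u i s r = p i * (m₀ r * D i s r + S i s r)) (k : ℕ) (φ : Fin 2 → C(Torus d, ℝ)) :
    siteAvg (fun x => (∑ i, colour a α i x * φ i (scalePt x)) * siteProfile a α D S (σ₀ k) x s)
      - ∑ i, ∫ r, φ i r * u i s r = ∑ i, profileError a p α σ₀ m₀ D S k i s (φ i) := by
  have e1 : ∀ i, ∫ r, φ i r * u i s r =
      p i * (∫ r, (φ i * D i s) r * m₀ r) + p i * ∫ r, (φ i * S i s) r * 1 := by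
    intro i
    rw [← mul_add, ← integral_add (integrable_torus_of_continuous (by fun_prop))
      (integrable_torus_of_continuous (by fun_prop)), ← integral_const_mul]
    refine integral_congr_ae (ae_of_all _ fun r => ?_)
    simp only [hus i r, ContinuousMap.mul_apply]
    ring
  have e2 : siteAvg (fun x =>
      (∑ i, colour a α i x * φ i (scalePt x)) * siteProfile a α D S (σ₀ k) x s) =
      ∑ i, (siteAvg (fun x => colour a α i x * spin (σ₀ k) x * (φ i * D i s) (scalePt x)) +
        siteAvg (fun x : Site d (2 * k + 1) =>
          colour a α i x * 1 * (φ i * S i s) (scalePt x))) := by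
    simp only [Fin.sum_univ_two, ← siteAvg_add]
    refine siteAvg_congr fun x => ?_
    obtain ⟨i, hi⟩ := exists_field_eq hα x
    rw [siteProfile_eq ha hi]
    simp only [colour_eq ha hi, ContinuousMap.mul_apply]
    fin_cases i
    · simp; ring
    · simp; ring
  rw [e2, ← Finset.sum_sub_distrib]
  refine Finset.sum_congr rfl fun i _ => ?_
  rw [e1]
  simp only [profileError, colouredError]
  ring

lemma tendsto_profileError {i : Fin 2}
    (h1 : ∀ φ, Tendsto (fun k => colouredError a p α i (fun k => spin (σ₀ k)) m₀ k φ)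
      atTop (𝓝 0))
    (h2 : ∀ φ, Tendsto (fun k => colouredError a p α i (fun _ _ => 1) (fun _ => 1) k φ)
      atTop (𝓝 0)) (s : ℝ) (φ : C(Torus d, ℝ)) :
    Tendsto (fun k => profileError a p α σ₀ m₀ D S k i s φ) atTop (𝓝 0) := by
  simpa only [profileError, add_zero] using (h1 (φ * D i s)).add (h2 (φ * S i s))

/-- The reflected translates `r' ↦ J (r - r')` of a continuous function. -/
noncomputable def translates (hJ : Continuous J) : C(Torus d, C(Torus d, ℝ)) :=
  ContinuousMap.curry ⟨fun q : Torus d × Torus d => J (q.1 - q.2), by fun_prop⟩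

lemma translates_apply (hJ : Continuous J) (r r' : Torus d) : translates hJ r r' = J (r - r') := rfl

/-- Uniformly in time and space, the interaction sees the limiting profile. -/
lemma eventually_profileError_translates_le (hJ : Continuous J) {i : Fin 2}
    (hp : p i ∈ Icc (0 : ℝ) 1) (hm₀ : Continuous m₀) (hm₀bd : ∀ r, |m₀ r| ≤ 1)
    (h1 : ∀ φ, Tendsto (fun k => colouredError a p α i (fun k => spin (σ₀ k)) m₀ k φ)
      atTop (𝓝 0))
    (h2 : ∀ φ, Tendsto (fun k => colouredError a p α i (fun _ _ => 1) (fun _ => 1) k φ)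
      atTop (𝓝 0)) {ε : ℝ} (hε : 0 < ε) :
    ∀ᶠ k in atTop, ∀ s ∈ Icc 0 T, ∀ r,
      |profileError a p α σ₀ m₀ D S k i s (translates hJ r)| ≤ ε := by
  -- All test functions that occur form a continuous image of `[0, T] × Λ`, hence a compact set in
  -- the uniform norm.
  have hK : ∀ F : Fin 2 → C(ℝ, C(Torus d, ℝ)),
      IsCompact ((fun q : ℝ × Torus d => translates hJ q.2 * F i q.1) '' (Icc 0 T ×ˢ univ)) :=
    fun F => (isCompact_Icc.prod isCompact_univ).image (by fun_prop)
  filter_upwards [eventually_forall_abs_le_of_isCompact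
      (fun k φ ψ => abs_colouredError_sub_le hp (fun k x => (abs_spin (σ₀ k) x).le) hm₀ hm₀bd k φ ψ)
      h1 (hK D) (half_pos hε),
    eventually_forall_abs_le_of_isCompact
      (fun k φ ψ => abs_colouredError_sub_le hp (s := fun _ _ => 1) (by simp) (g := fun _ => 1)
        continuous_const (by simp) k φ ψ) h2 (hK S) (half_pos hε)] with k hk1 hk2
  intro s hs r
  have m1 := hk1 (translates hJ r * D i s) ⟨(s, r), ⟨hs, mem_univ _⟩, rfl⟩
  have m2 := hk2 (translates hJ r * S i s) ⟨(s, r), ⟨hs, mem_univ _⟩, rfl⟩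
  exact (abs_add_le _ _).trans (by linarith)

/-- Once the fluctuation about the profile is split off as a deviation with weight `J(γ(x - ·))`,
only the profile error and the self-interaction remain. Both are small uniformly in the
configuration. -/
lemma microField_sub_limitField (hJ : Continuous J) (hT : 0 ≤ T) (hm₀ : Continuous m₀)
    (ha : a 0 ≠ a 1) (hα : ∀ z, ∃ i, α z = a i) {s : ℝ} (hs : s ∈ Icc 0 T)
    (hus : ∀ i r, u i s r = p i * (m₀ r * D i s r + S i s r)) {k : ℕ} {x : Site d (2 * k + 1)}
    {i : Fin 2} (hi : field α x = a i) (η : Config d (2 * k + 1)) :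
    microField J θ α x η
        - deviation (fun y => J (scalePt (x - y))) (fun y => siteProfile a α D S (σ₀ k) y s) η
        - limitField J θ a hT u i s (scalePt x) =
      ∑ l, profileError a p α σ₀ m₀ D S k l s (translates hJ (scalePt x))
        - (((2 * k + 1 : ℕ) : ℝ)⁻¹) ^ d * J 0 * spin η x := by
  have e3 : siteAvg (fun y => J (scalePt (x - y)) * spin η y)
      - deviation (fun y => J (scalePt (x - y))) (fun y => siteProfile a α D S (σ₀ k) y s) η =
      siteAvg (fun y => (∑ l, colour a α l y * translates hJ (scalePt x) (scalePt y)) *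
        siteProfile a α D S (σ₀ k) y s) := by
    rw [deviation, ← siteAvg_sub]
    refine siteAvg_congr fun y => ?_
    rw [← Finset.sum_mul, sum_colour ha hα, translates_apply, scalePt_sub]
    ring
  have e4 : limitField J θ a hT u i s (scalePt x) =
      ∑ l, (∫ r, translates hJ (scalePt x) r * u l s r) + θ * field α x := by
    rw [Fin.sum_univ_two, ← integral_add (integrable_torus_of_continuous (by fun_prop))
      (integrable_torus_of_continuous (by fun_prop)), hi]
    simp only [limitField, localField, torusConv, projIcc_of_mem hT hs, translates_apply, mul_add]
    ring
  rw [← siteAvg_siteProfile_sub hm₀ ha hα hus k fun _ => translates hJ (scalePt x), ← e3, e4,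
    microField]
  ring

lemma tendsto_inv_card (hd : 0 < d) :
    Tendsto (fun k : ℕ => (((2 * k + 1 : ℕ) : ℝ)⁻¹) ^ d) atTop (𝓝 0) := by
  have h3 : Tendsto (fun k : ℕ => ((2 * k + 1 : ℕ) : ℝ)⁻¹) atTop (𝓝 0) :=
    tendsto_inv_atTop_zero.comp (tendsto_natCast_atTop_atTop.comp
      (tendsto_atTop_mono (fun k => by omega : ∀ k : ℕ, k ≤ 2 * k + 1) tendsto_id))
  simpa [hd.ne'] using h3.pow d

/-- The mean square deviation of the particle system from the lattice profile vanishes. -/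
lemma IsCharacteristic.eventually_deviation_sq_le {hT : 0 ≤ T}
    (hDS : IsCharacteristic J θ a p V hT m₀ u D S) (hd : 0 < d) (hJ : Continuous J)
    (hJsymm : ∀ r, J (-r) = J r) (ha : a 0 ≠ a 1) (hp : ∀ i, p i ∈ Icc (0 : ℝ) 1)
    (hV : ∀ i, Continuous (Function.uncurry (V i))) {c : ℝ} (hc : ∀ i s r, |V i s r| ≤ c)
    (hm₀ : Continuous m₀) (hm₀bd : ∀ r, |m₀ r| ≤ 1) (hα : ∀ z, ∃ i, α z = a i)
    (h1 : ∀ i φ, Tendsto (fun k => colouredError a p α i (fun k => spin (σ₀ k)) m₀ k φ)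
      atTop (𝓝 0))
    (h2 : ∀ i φ, Tendsto (fun k => colouredError a p α i (fun _ _ => 1) (fun _ => 1) k φ)
      atTop (𝓝 0))
    {Q : ∀ k : ℕ, Measure (PathSpace d (2 * k + 1) T)}
    (hQ : ∀ k, IsGlauberLaw J θ a V α hT (σ₀ k) (Q k)) {t : ℝ} (ht : t ∈ Icc 0 T) {ε : ℝ}
    (hε : 0 < ε) :
    ∀ᶠ k in atTop, ∀ g : Site d (2 * k + 1) → ℝ, (∀ x, |g x| ≤ 1) →
      ∑ η, marginal hT (Q k) t η *
        deviation g (fun x => siteProfile a α D S (σ₀ k) x t) η ^ 2 ≤ ε := by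
  obtain ⟨j, hj0, hj⟩ : ∃ j, 0 < j ∧ ∀ r, |J r| ≤ j := by
    obtain ⟨j, hj0, hj⟩ := exists_abs_le hJ
    exact ⟨j + 1, by linarith, fun r => (hj r).trans (by linarith)⟩
  set E := Real.exp (2 * c)
  set R := Real.exp (2 * (2 + E ^ 2 + 2 * E ^ 2 * j ^ 2) * T)
  -- A single `κ` bounds both the field error and `n⁻ᵈ`. The thirds below are for the two colours
  -- and the self-interaction.
  have hlim : Tendsto (fun κ : ℝ => 2 * (2 * E ^ 2 * κ ^ 2 + 4 * κ * E) * T * R) (𝓝[>] 0)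
      (𝓝 0) := by
    have : Continuous fun κ : ℝ => 2 * (2 * E ^ 2 * κ ^ 2 + 4 * κ * E) * T * R := by fun_prop
    simpa using (this.tendsto 0).mono_left nhdsWithin_le_nhds
  obtain ⟨κ, hκε, hκ : 0 < κ⟩ :=
    ((hlim.eventually_lt_const hε).and self_mem_nhdsWithin).exists
  have hN := (tendsto_inv_card hd).eventually_lt_const (by positivity : 0 < κ / 3 / j)
  have herr := fun i => eventually_profileError_translates_le (T := T) (D := D) (S := S) hJ (hp i)
    hm₀ hm₀bd (h1 i) (h2 i) (by positivity : 0 < κ / 3)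
  filter_upwards [herr 0, herr 1, hN, (tendsto_inv_card hd).eventually_lt_const hκ]
    with k k0 k1 k2 k3
  intro g hg
  choose col hcol using exists_field_eq (n := 2 * k + 1) hα
  have hpot : ∀ (x : Site d (2 * k + 1)) s, potential a V α s x = V (col x) s (scalePt x) := by
    intro x s
    simp [potential, colour_eq ha (hcol x)]
  refine ((hQ k).deviation_sq_le hJsymm
    (fun i r => (hV i).comp (by fun_prop : Continuous fun s : ℝ => (s, r))) hj0 hj
    (fun s _ x => by rw [hpot]; exact hc _ _ _)
    (u := fun x s => siteProfile a α D S (σ₀ k) x s)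
    (hbar := fun x s => limitField J θ a hT u (col x) s (scalePt x))
    (κ := κ) (fun x => ?_) (fun x s _ => ?_) (fun s hs x η => ?_) hg ht).trans
      (le_trans ?_ hκε.le)
  · rw [siteProfile_eq ha (hcol x), hDS.propagator_zero, hDS.inhomogeneous_zero, mul_one, add_zero]
  · simp only [hpot, siteProfile_eq ha (hcol x)]
    exact (hDS.deriv (col x) (spin (σ₀ k) x) s (scalePt x)).hasDerivWithinAt
  · have e5 : |(((2 * k + 1 : ℕ) : ℝ)⁻¹) ^ d * J 0 * spin η x| ≤ κ / 3 := by
      rw [abs_mul, abs_spin, mul_one, abs_mul, abs_of_nonneg (by positivity)]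
      rw [lt_div_iff₀ hj0] at k2
      exact (mul_le_mul_of_nonneg_left (hj 0) (by positivity)).trans k2.le
    rw [microField_sub_limitField hJ hT hm₀ ha hα hs (fun i r => hDS.eq i s hs r) (hcol x) η,
      Fin.sum_univ_two]
    have e0 := k0 s hs (scalePt x)
    have e1 := k1 s hs (scalePt x)
    rw [abs_le] at e0 e1 e5 ⊢
    constructor <;> linarith [e0.1, e0.2, e1.1, e1.2, e5.1, e5.2]
  · gcongr

lemma colouredEmpirical_eq_siteAvg {n : ℕ} [NeZero n] (η : Config d n) (G : Fin 2 → Torus d → ℝ) :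
    colouredEmpirical a α η G =
      siteAvg fun x => (∑ i, colour a α i x * G i (scalePt x)) * spin η x := by
  simp only [colouredEmpirical, siteAvg, Fin.sum_univ_two, ← mul_add, ← Finset.sum_add_distrib]
  congr 1
  exact Finset.sum_congr rfl fun x _ => by ring

/-- The Chebyshev inequality for the deviation at a fixed time. -/
lemma measureReal_le_abs_deviation {n : ℕ} [NeZero n] (hT : 0 ≤ T) (Q : Measure (PathSpace d n T))
    [IsProbabilityMeasure Q] (t : Icc (0 : ℝ) T) (g v : Site d n → ℝ) {ε : ℝ} (hε : 0 ≤ ε) :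
    ε ^ 2 * Q.real {w | ε ≤ |deviation g v (w.1 t)|} ≤
      ∑ η, marginal hT Q t η * deviation g v η ^ 2 := by
  have hint := integral_path_eq_sum hT Q t fun η => deviation g v η ^ 2
  rw [projIcc_val] at hint
  rw [← hint]
  have hset : {w : PathSpace d n T | ε ≤ |deviation g v (w.1 t)|} =
      {w | ε ^ 2 ≤ deviation g v (w.1 t) ^ 2} := by
    ext w
    rw [mem_ofPred_eq, mem_ofPred_eq, ← sq_abs (deviation g v (w.1 t)),
      pow_le_pow_iff_left₀ hε (abs_nonneg _) two_ne_zero]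
  rw [hset]
  refine mul_meas_ge_le_integral_of_nonneg (ae_of_all _ fun w => sq_nonneg _) ?_ _
  obtain ⟨C, hC⟩ := (Set.finite_range fun η : Config d n =>
    deviation g v η ^ 2).isBounded.exists_norm_le
  exact Integrable.of_bound ((measurable_of_finite fun η : Config d n =>
    deviation g v η ^ 2).comp (measurable_eval t)).aestronglyMeasurable C
      (ae_of_all _ fun w => hC _ (mem_range_self _))

/-- Convergence of the coloured empirical measures for a fixed realisation of the random field
along which the coloured averages of the initial data converge. -/
lemma IsCharacteristic.tendsto_measure {hT : 0 ≤ T}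
    (hDS : IsCharacteristic J θ a p V hT m₀ u D S) (hd : 0 < d) (hJ : Continuous J)
    (hJsymm : ∀ r, J (-r) = J r) (ha : a 0 ≠ a 1) (hp : ∀ i, p i ∈ Icc (0 : ℝ) 1)
    (hV : ∀ i, Continuous (Function.uncurry (V i))) {c : ℝ} (hc : ∀ i s r, |V i s r| ≤ c)
    (hm₀ : Continuous m₀) (hm₀bd : ∀ r, |m₀ r| ≤ 1) (hα : ∀ z, ∃ i, α z = a i)
    (h1 : ∀ i φ, Tendsto (fun k => colouredError a p α i (fun k => spin (σ₀ k)) m₀ k φ)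
      atTop (𝓝 0))
    (h2 : ∀ i φ, Tendsto (fun k => colouredError a p α i (fun _ _ => 1) (fun _ => 1) k φ)
      atTop (𝓝 0))
    {Q : ∀ k : ℕ, Measure (PathSpace d (2 * k + 1) T)}
    (hQ : ∀ k, IsGlauberLaw J θ a V α hT (σ₀ k) (Q k)) (t : Icc (0 : ℝ) T)
    {G : Fin 2 → Torus d → ℝ} (hG : ∀ i, Continuous (G i)) {δ : ℝ} (hδ : 0 < δ) :
    Tendsto (fun k => Q k {w | δ ≤ |colouredEmpirical a α (w.1 t) G
      - ∑ i, ∫ r, G i r * u i t r|}) atTop (𝓝 0) := by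
  let φ : Fin 2 → C(Torus d, ℝ) := fun i => ⟨G i, hG i⟩
  -- `b` normalises the weight to absolute value at most one; the added `1` keeps it positive.
  let b : ℝ := ‖φ 0‖ + ‖φ 1‖ + 1
  have hb : 0 < b := by positivity
  let g : ∀ k : ℕ, Site d (2 * k + 1) → ℝ := fun k x =>
    b⁻¹ * ∑ i, colour a α i x * φ i (scalePt x)
  have hg : ∀ k x, |g k x| ≤ 1 := by
    intro k x
    have hi : ∀ i, |colour a α i x * φ i (scalePt x)| ≤ ‖φ i‖ := fun i => by
      rw [abs_mul]
      exact (mul_le_of_le_one_left (abs_nonneg _) (abs_colour_le a α i x)).trans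
        ((φ i).norm_coe_le_norm (scalePt x))
    rw [abs_mul, abs_of_pos (inv_pos.2 hb), inv_mul_le_iff₀ hb, mul_one, Fin.sum_univ_two]
    have := abs_add_le (colour a α 0 x * φ 0 (scalePt x)) (colour a α 1 x * φ 1 (scalePt x))
    linarith [hi 0, hi 1]
  have hemp : ∀ (k : ℕ) (η : Config d (2 * k + 1)),
      colouredEmpirical a α η G - ∑ i, ∫ r, G i r * u i t r =
        b * deviation (g k) (fun x => siteProfile a α D S (σ₀ k) x t) η +
          ∑ i, profileError a p α σ₀ m₀ D S k i t (φ i) := by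
    intro k η
    have e2 : deviation (fun x => b * g k x) (fun x => siteProfile a α D S (σ₀ k) x t) η =
        siteAvg (fun x => (∑ i, colour a α i x * φ i (scalePt x)) * spin η x) -
          siteAvg (fun x => (∑ i, colour a α i x * φ i (scalePt x)) *
            siteProfile a α D S (σ₀ k) x t) := by
      rw [deviation, ← siteAvg_sub]
      refine siteAvg_congr fun x => ?_
      simp only [g, mul_inv_cancel_left₀ hb.ne']
      ring
    rw [← siteAvg_siteProfile_sub hm₀ ha hα (fun i r => hDS.eq i t t.2 r), ← deviation_smul, e2,
      colouredEmpirical_eq_siteAvg, sub_add_sub_cancel]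
    rfl
  have herr : Tendsto (fun k => |∑ i, profileError a p α σ₀ m₀ D S k i t (φ i)|) atTop (𝓝 0) := by
    simpa using (tendsto_finsetSum Finset.univ fun (i : Fin 2) _ =>
      tendsto_profileError (D := D) (S := S) (h1 i) (h2 i) t (φ i)).abs
  have hreal : Tendsto (fun k => (Q k).real {w | δ ≤ |colouredEmpirical a α (w.1 t) G
      - ∑ i, ∫ r, G i r * u i t r|}) atTop (𝓝 0) := by
    rw [Metric.tendsto_nhds]
    intro ε hε
    have hq : 0 < (δ / 2 / b) ^ 2 := by positivity
    filter_upwards [herr.eventually_lt_const (half_pos hδ),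
      hDS.eventually_deviation_sq_le hd hJ hJsymm ha hp hV hc hm₀ hm₀bd hα h1 h2 hQ t.2
        (by positivity : 0 < (δ / 2 / b) ^ 2 * (ε / 2))] with k hk1 hk2
    have := (hQ k).1
    -- The nonrandom profile error takes up less than `δ / 2`, so the deviation must account for the
    -- other half.
    have hsub : (Q k).real {w | δ ≤ |colouredEmpirical a α (w.1 t) G
        - ∑ i, ∫ r, G i r * u i t r|} ≤ (Q k).real {w | δ / 2 / b ≤
          |deviation (g k) (fun x => siteProfile a α D S (σ₀ k) x t) (w.1 t)|} := by
      refine measureReal_mono fun w hw => ?_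
      rw [mem_ofPred_eq, hemp] at hw
      rw [mem_ofPred_eq, div_le_iff₀' hb]
      have hmul := abs_mul b (deviation (g k) (fun x => siteProfile a α D S (σ₀ k) x t) (w.1 t))
      rw [abs_of_pos hb] at hmul
      linarith [hw.trans (abs_add_le _ _)]
    have h6 := le_of_mul_le_mul_left ((measureReal_le_abs_deviation hT (Q k) t (g k)
      (fun x => siteProfile a α D S (σ₀ k) x t) (ε := δ / 2 / b) (by positivity)).trans
        (hk2 (g k) (hg k))) hq
    rw [Real.dist_eq, sub_zero, abs_of_nonneg measureReal_nonneg]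
    linarith
  have h7 := ENNReal.tendsto_ofReal hreal
  rw [ENNReal.ofReal_zero] at h7
  refine h7.congr fun k => ?_
  have := (hQ k).1
  exact ofReal_measureReal

end SiteProfile

end KacGlauber

theorem theorem5p1 {d : ℕ} (hd : 0 < d)
    (J : Torus d → ℝ) (hJ : IsC1 J) (hJsymm : ∀ r, J (-r) = J r) (hJint : ∫ r, J r = 1)
    (θ : ℝ) (hθ : 0 < θ) (a p : Fin 2 → ℝ) (ha : a 0 ≠ a 1) (hp : p 0 + p 1 = 1)
    {Ω : Type*} [MeasurableSpace Ω] (P : Measure Ω) [IsProbabilityMeasure P]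
    (α : (Fin d → ℤ) → Ω → ℝ) (hαmeas : ∀ x, Measurable (α x)) (hαindep : iIndepFun α P)
    (hαlaw : ∀ x i, P.real {ω | α x ω = a i} = p i)
    (T : ℝ) (hT : 0 < T)
    (V : Fin 2 → ℝ → Torus d → ℝ) (hV : ∀ i, IsC10 T (V i))
    (m₀ : Torus d → ℝ) (hm₀ : Continuous m₀) (hm₀bd : ∀ r, |m₀ r| ≤ 1)
    (σ₀ : ∀ k : ℕ, Config d (2 * k + 1))
    (hσ₀ : ∀ G : Torus d → ℝ, Continuous G →
      Tendsto (fun k => empirical (σ₀ k) G) atTop (𝓝 (∫ r, G r * m₀ r))) :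
    ∃ m : Fin 2 → ℝ → Lp ℝ ∞ (volume : Measure (Torus d)),
      IsSolution J θ a p V T m₀ m ∧
      (∀ m' : Fin 2 → ℝ → Lp ℝ ∞ (volume : Measure (Torus d)),
        IsSolution J θ a p V T m₀ m' → ∀ i, EqOn (m' i) (m i) (Icc 0 T)) ∧
      ∀ᵐ ω ∂P, ∀ Q : ∀ k : ℕ, Measure (PathSpace d (2 * k + 1) T),
        (∀ k, IsGlauberLaw J θ a V (fun x => α x ω) hT.le (σ₀ k) (Q k)) →
        ∀ (t : Icc (0 : ℝ) T) (G : Fin 2 → Torus d → ℝ), (∀ i, IsC1 (G i)) →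
        ∀ δ : ℝ, 0 < δ →
          Tendsto
            (fun k => Q k {w | δ ≤ |colouredEmpirical a (fun x => α x ω) (w.1 t) G
              - ∑ i, ∫ r, G i r * m i t r|})
            atTop (𝓝 0) := by
  have hJc := hJ.continuous
  have hp' := prob_mem hαlaw
  -- The potential is extended constantly in time outside `[0, T]`, which makes it continuous and
  -- bounded on all of `ℝ × Λ`.
  let W : Fin 2 → ℝ → Torus d → ℝ := fun i s r => V i (projIcc 0 T hT.le s) r
  have hWV : ∀ i, ∀ s ∈ Icc 0 T, ∀ r, V i s r = W i s r := fun i s hs r => by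
    simp only [W, projIcc_of_mem hT.le hs]
  have hVc : ∀ i, Continuous fun q : Icc (0 : ℝ) T × Torus d => V i q.1 q.2 := fun i =>
    (hV i).1.comp_continuous (f := fun q : Icc (0 : ℝ) T × Torus d => ((q.1 : ℝ), q.2))
      (by fun_prop) fun q => ⟨q.1.2, mem_univ _⟩
  have hWc : ∀ i, Continuous (Function.uncurry (W i)) := fun i =>
    (hVc i).comp (f := fun q : ℝ × Torus d => (projIcc 0 T hT.le q.1, q.2))
      ((continuous_projIcc.comp continuous_fst).prodMk continuous_snd)
  obtain ⟨c, hc⟩ : ∃ c, ∀ i s r, |W i s r| ≤ c := by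
    choose c hc0 hc using fun i => exists_abs_le (hVc i)
    refine ⟨c 0 + c 1, fun i s r => (hc i (projIcc 0 T hT.le s, r)).trans ?_⟩
    fin_cases i <;> simp [hc0]
  obtain ⟨u, hu⟩ := exists_isContinuousSolution (θ := θ) (a := a) hJc hp' hWc hc hT.le hm₀ hm₀bd
  have huV : IsContinuousSolution J θ a p V T m₀ u := by
    refine ⟨hu.init, hu.bound, fun i t ht => ?_⟩
    obtain ⟨D, hD, hDer⟩ := hu.deriv i t ht
    exact ⟨D, fun r => by rw [hD, hWV i t ht], hDer⟩
  refine ⟨fun i t => toLinfty (u i t), huV.isSolution, fun m' hm' i => ?_, ?_⟩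
  · exact huV.eqOn hJc hp' (fun i t ht r => by rw [hWV i t ht]; exact hc i t r) hm' i
  -- Two laws of large numbers at time zero: one for the initial spins, with density `m₀`, and one
  -- for the constant `1`, where the means are Riemann sums. Their null sets involve neither `Q`,
  -- `t`, `G` nor `δ`.
  have h1 := fun i => ae_forall_tendsto_colouredError hd hαmeas hαindep hαlaw i
    (s := fun k => spin (σ₀ k)) (fun k x => (abs_spin _ _).le) hm₀ hm₀bd hσ₀
  have h2 := fun i => ae_forall_tendsto_colouredError hd hαmeas hαindep hαlaw i
    (s := fun _ _ => 1) (fun k x => by simp) (g := fun _ => 1) continuous_const (by simp)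
    fun φ hφ => by simpa using tendsto_siteAvg hφ
  filter_upwards [ae_all_iff.2 h1, ae_all_iff.2 h2, ae_mem_colours hαmeas ha hp hαlaw]
    with ω hω1 hω2 hω3
  intro Q hQ t G hG δ hδ
  obtain ⟨D, S, hDS⟩ := hu.exists_isCharacteristic hJc hT.le hWc
  have key := hDS.tendsto_measure hd hJc hJsymm ha hp' hWc hc hm₀ hm₀bd hω3 hω1 hω2
    (fun k => (hQ k).congr hWV) t (fun i => (hG i).continuous) hδ
  have e : ∀ i, ∫ r, G i r * toLinfty (u i t) r = ∫ r, G i r * u i t r := fun i =>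
    integral_congr_ae (by filter_upwards [coeFn_toLinfty (u i t)] with r hr; rw [hr])
  simpa only [e] using key
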